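/- Let $X$ be a Banach space over $\mathbb{K}\in\{\mathbb{R},\mathbb{C}\}$, let $\xi$ be an ordinal, and let $K\subset X^*$ be weak$^*$-compact. For $L\subset X^*$ and $\varepsilon>0$ let $s_\varepsilon(L)$ be the set of those $x^*\in L$ such that $\operatorname{diam}(V\cap L)>\varepsilon$ (norm diameter) for every weak$^*$-neighborhood $V$ of $x^*$. Put $s_\varepsilon^0(L)=L$, $s_\varepsilon^{\zeta+1}(L)=s_\varepsilon(s_\varepsilon^\zeta(L))$, and $s_\varepsilon^\zeta(L)=\bigcap_{\eta<\zeta}s_\varepsilon^\eta(L)$ for limit ordinals $\zeta$; put $s_\varepsilon^\zeta(L)=L$ for $\varepsilon\le 0$. Let $Sz(L,\varepsilon)$ be the least ordinal $\zeta$ with $s^\zeta_\varepsilon(L)=\varnothing$ ($\infty$ if there is none), and $Sz(L)=\sup_{\varepsilon>0}Sz(L,\varepsilon)$. For $1\le q<\infty$, $L$ has \emph{$\xi$-$q$-summable Szlenk index} if there is $M\ge 0$ such that $\sum_{i=1}^n\varepsilon_i^q\le M^q$ whenever $\varepsilon_1,\dots,\varepsilon_n\ge 0$ and $s^{\omega^\xi}_{\varepsilon_1}\cdots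 s^{\omega^\xi}_{\varepsilon_n}(L)\neq\varnothing$. For non-empty weak$^*$-compact $L$, the \emph{$\xi$-Szlenk power type} is $\mathbf{p}_\xi(L)=\limsup_{\varepsilon\to0^+}\frac{\log Sz_\xi(L,\varepsilon)}{|\log\varepsilon|}\in[0,\infty]$ if $Sz(L)\le\omega^{\xi+1}$, where $Sz_\xi(L,\varepsilon)$ is the least $n\in\mathbb{N}$ with $Sz(L,\varepsilon)\le\omega^\xi n$, and $\mathbf{p}_\xi(L)=\infty$ if $Sz(L)>\omega^{\xi+1}$. Let $\widetilde K=\overline{\mathrm{abs\,co}}^{\,\mathrm{weak}^*}(K)$ be the weak$^*$-closed absolutely convex hull of $K$. Then: (i) For every $1\le q<\infty$, $K$ has $\xi$-$q$-summable Szlenk index if and only if $\widetilde K$ does. (ii) If $Sz(K)>\omega^\xi$, then $\mathbf{p}_\xi(\widetilde K)=\max\{\mathbf{p}_\xi(K),1\}$. If $K\neq\varnothing$ and $Sz(K)\le\omega^\xi$, then $\mathbf{p}_\xi(K)=\mathbf{p}_\xi(\widetilde K)=0$. -/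

import Mathlib

open Filter Topology

open scoped ComplexOrder

universe u v w

noncomputable section

namespace SzlenkIndex

variable {𝕜 : Type u} [RCLike 𝕜] {X : Type v} [NormedAddCommGroup X] [NormedSpace 𝕜 X]

/-- The derivation `s_ε(K)` for `ε > 0`: the points `x*` of `K` such that, for every
weak*-neighbourhood `V` of `x*`, the norm diameter of `V ∩ K` is greater than `ε`, that is, `V ∩ K`
contains two points at norm distance greater than `ε`. By convention `s_ε(K) = K` for `ε ≤ 0`. -/
def szlenkDeriv (ε : ℝ) (K : Set (WeakDual 𝕜 X)) : Set (WeakDual 𝕜 X) :=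
  {x | x ∈ K ∧ (0 < ε → ∀ V ∈ 𝓝 x, ∃ y ∈ V ∩ K, ∃ z ∈ V ∩ K,
    ε < ‖WeakDual.toStrongDual y - WeakDual.toStrongDual z‖)}

/-- The transfinite derivations: `s_ε^0(K) = K`, `s_ε^{ζ+1}(K) = s_ε(s_ε^ζ(K))`, and
`s_ε^ξ(K) = ⋂_{ζ < ξ} s_ε^ζ(K)` for a limit ordinal `ξ`. -/
def derivIter (ε : ℝ) (ξ : Ordinal.{w}) (K : Set (WeakDual 𝕜 X)) : Set (WeakDual 𝕜 X) :=
  Ordinal.limitRecOn (motive := fun _ => Set (WeakDual 𝕜 X)) ξ K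
    (fun _ L => szlenkDeriv ε L) (fun ξ _ L => ⋂ ζ : Set.Iio ξ, L ζ.1 ζ.2)

theorem derivIter_zero (ε : ℝ) (K : Set (WeakDual 𝕜 X)) :
    derivIter ε (0 : Ordinal.{w}) K = K :=
  Ordinal.limitRecOn_zero ..

theorem derivIter_add_one (ε : ℝ) (ζ : Ordinal.{w}) (K : Set (WeakDual 𝕜 X)) :
    derivIter ε (ζ + 1) K = szlenkDeriv ε (derivIter ε ζ K) :=
  Ordinal.limitRecOn_add_one ..

theorem derivIter_limit (ε : ℝ) (ξ : Ordinal.{w}) (hξ : Order.IsSuccLimit ξ)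
    (K : Set (WeakDual 𝕜 X)) :
    derivIter ε ξ K = ⋂ ζ : Set.Iio ξ, derivIter ε ζ.1 K :=
  Ordinal.limitRecOn_limit _ _ _ _ hξ

/-- `Sz(K, ε)`: the least ordinal `ζ` with `s_ε^ζ(K) = ∅`, and `⊤` if there is none. -/
def szlenkAt (K : Set (WeakDual 𝕜 X)) (ε : ℝ) : WithTop Ordinal.{w} :=
  sInf ((fun ζ : Ordinal.{w} => (ζ : WithTop Ordinal.{w})) '' {ζ | derivIter ε ζ K = ∅})

/-- The Szlenk index `Sz(K) = sup_{ε > 0} Sz(K, ε)`. -/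
def szlenk (K : Set (WeakDual 𝕜 X)) : WithTop Ordinal.{w} :=
  ⨆ ε : {ε : ℝ // 0 < ε}, szlenkAt K ε.1

/-- `s_{ε₁}^{ζ} ⋯ s_{εₙ}^{ζ}(K)` for a list `[ε₁, …, εₙ]`; the derivation with `εₙ` is applied
first. -/
def derivList (ζ : Ordinal.{w}) (l : List ℝ) (K : Set (WeakDual 𝕜 X)) : Set (WeakDual 𝕜 X) :=
  l.foldr (fun ε L => derivIter ε ζ L) K

/-- `K` has `M`-`ξ`-`q`-summable Szlenk index. -/
def HasSummableWith (M : ℝ) (ξ : Ordinal.{w}) (q : ℝ) (K : Set (WeakDual 𝕜 X)) : Prop :=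
  ∀ l : List ℝ, (∀ ε ∈ l, 0 ≤ ε) → (derivList (Ordinal.omega0 ^ ξ) l K).Nonempty →
    (l.map fun ε => ε ^ q).sum ≤ M ^ q

/-- `K` has `ξ`-`q`-summable Szlenk index. -/
def HasSummable (ξ : Ordinal.{w}) (q : ℝ) (K : Set (WeakDual 𝕜 X)) : Prop :=
  ∃ M : ℝ, 0 ≤ M ∧ HasSummableWith M ξ q K

/-- `Sz_ξ(K, ε)`: the least natural number `n` with `Sz(K, ε) ≤ ω^ξ · n`. It is only used when
`Sz(K) ≤ ω^(ξ+1)`, in which case such an `n` exists by weak*-compactness. -/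
def szlenkNat (ξ : Ordinal.{w}) (K : Set (WeakDual 𝕜 X)) (ε : ℝ) : ℕ :=
  sInf {n : ℕ | szlenkAt K ε ≤ ((Ordinal.omega0 ^ ξ * (n : Ordinal.{w}) : Ordinal.{w}) :
    WithTop Ordinal.{w})}

open Classical in
/-- The `ξ`-Szlenk power type `p_ξ(K) = limsup_{ε → 0⁺} log Sz_ξ(K, ε) / |log ε|`, a value in
`[0, ∞]`, if `Sz(K) ≤ ω^(ξ+1)`, and `p_ξ(K) = ∞` otherwise. -/
def powerType (ξ : Ordinal.{w}) (K : Set (WeakDual 𝕜 X)) : EReal :=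
  if szlenk K ≤ ((Ordinal.omega0 ^ (ξ + 1) : Ordinal.{w}) : WithTop Ordinal.{w}) then
    limsup (fun ε : ℝ => ((Real.log (szlenkNat ξ K ε) / |Real.log ε| : ℝ) : EReal)) (𝓝[>] 0)
  else ⊤

/-- The weak*-closed absolutely convex hull of `K`. -/
def weakStarAbsCo (K : Set (WeakDual 𝕜 X)) : Set (WeakDual 𝕜 X) :=
  closure (absConvexHull 𝕜 K)

end SzlenkIndex

end

/-!
For a compact set `G` with closed convex hull `C`, record how long the points of `G` survive: the
graph of `G` consists of the pairs `(g, b)` such that `g` survives the derivations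
`s_c ^ {ω ^ ξ}(G)` for all `c < b`. The main point is that `(q, ε / 2)` lies in the closed convex
hull of this graph whenever `q ∈ s_ε ^ {ω ^ ξ}(C)`.

For `ξ = 0`, a pair `(q, ε / 2)` outside that hull is separated from the graph by a continuous
affine function `h` with `h q < ε / 2` such that each `g ∈ G` has a neighbourhood in `G` of diameter
at most `h g`. Averaging over finitely many compact convex pieces, the points of `C` near `q` have
distance at most `h q`, up to an arbitrarily small error, from `q`; but `q ∈ s_ε(C)` has points of
`C` arbitrarily close to it at distance more than `ε / 2`. Applied in `E × ℝⁿ`, the claim for a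
single derivation yields the one for a sequence of derivations. When these have the same `ε`, one
averages the `n` survival levels: for large `n`, many of them are close to the average or above it,
which gives the step from `ω ^ ξ` to `ω ^ (ξ + 1)`, and limit ordinals follow by compactness.

A continuous convex function of the survival levels is bounded on the closed convex hull of the
graph as soon as it is bounded on the graph. Since `∑ εᵢ ^ q` is such a function for `q ≥ 1`, and
passing to the balanced hull only replaces `ε` by `ε / 4`, this gives (i).

A power type less than `r` bounds by `(B / ε) ^ r` the number of derivations that `K` survives at
level `ε`, and this bound implies `q`-summability for all `q > r`. Hence (i) gives the upper bound
in (ii). For the lower bound, the absolutely convex hull contains the averages of `n` points of `K`,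
so if `x ∈ s_δ ^ {ω ^ ξ}(K)`, moving these points one at a time shows that `x` survives `n`
derivations at level `δ / n` of the hull.
-/

noncomputable section

namespace SzlenkIndex

section TransfiniteIter

variable {α β : Type*}

/-- The transfinite iterates of a derivation `d` on sets: `d^0(S) = S`, `d^{ζ+1}(S) = d(d^ζ(S))`,
with intersections at limit ordinals. The derivations of the Szlenk index are of this form. -/
def transfiniteIter (d : Set α → Set α) (ζ : Ordinal.{w}) (S : Set α) : Set α :=
  Ordinal.limitRecOn (motive := fun _ => Set α) ζ S
    (fun _ L => d L) (fun ζ _ L => ⋂ η : Set.Iio ζ, L η.1 η.2)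

theorem transfiniteIter_zero (d : Set α → Set α) (S : Set α) :
    transfiniteIter d (0 : Ordinal.{w}) S = S :=
  Ordinal.limitRecOn_zero ..

theorem transfiniteIter_add_one (d : Set α → Set α) (ζ : Ordinal.{w}) (S : Set α) :
    transfiniteIter d (ζ + 1) S = d (transfiniteIter d ζ S) :=
  Ordinal.limitRecOn_add_one ..

theorem transfiniteIter_limit (d : Set α → Set α) {ζ : Ordinal.{w}} (hζ : Order.IsSuccLimit ζ)
    (S : Set α) : transfiniteIter d ζ S = ⋂ η : Set.Iio ζ, transfiniteIter d η.1 S :=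
  Ordinal.limitRecOn_limit _ _ _ _ hζ

theorem transfiniteIter_one (d : Set α → Set α) (S : Set α) :
    transfiniteIter d (1 : Ordinal.{w}) S = d S := by
  rw [← zero_add (1 : Ordinal.{w}), transfiniteIter_add_one, transfiniteIter_zero]

theorem transfiniteIter_of_fixed {d : Set α → Set α} {S : Set α} (hd : d S = S)
    (ζ : Ordinal.{w}) : transfiniteIter d ζ S = S := by
  induction ζ using Ordinal.limitRecOn with
  | zero => rw [transfiniteIter_zero]
  | add_one ζ ih => rw [transfiniteIter_add_one, ih, hd]
  | limit ζ hζ ih =>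
    have : Nonempty (Set.Iio ζ) := ⟨⟨0, hζ.bot_lt⟩⟩
    rw [transfiniteIter_limit d hζ, Set.iInter_congr fun η : Set.Iio ζ => ih η.1 η.2,
      Set.iInter_const]

theorem mapsTo_transfiniteIter {d : Set α → Set α} {d' : Set β → Set β} {T : α → β} {U : Set α}
    (hd : ∀ A B, Set.MapsTo T (A ∩ U) B → Set.MapsTo T (d A ∩ U) (d' B)) {A : Set α} {B : Set β}
    (hAB : Set.MapsTo T (A ∩ U) B) (ζ : Ordinal.{w}) :
    Set.MapsTo T (transfiniteIter d ζ A ∩ U) (transfiniteIter d' ζ B) := by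
  induction ζ using Ordinal.limitRecOn with
  | zero => simpa only [transfiniteIter_zero] using hAB
  | add_one ζ ih =>
    simp only [transfiniteIter_add_one]
    exact hd _ _ ih
  | limit ζ hζ ih =>
    simp only [transfiniteIter_limit _ hζ]
    exact fun x hx => Set.mem_iInter.2 fun η =>
      ih η.1 η.2 ⟨Set.mem_iInter.1 hx.1 η, hx.2⟩

theorem isClosed_transfiniteIter [TopologicalSpace α] {d : Set α → Set α}
    (hd : ∀ S, IsClosed S → IsClosed (d S)) {S : Set α} (hS : IsClosed S) (ζ : Ordinal.{w}) :
    IsClosed (transfiniteIter d ζ S) := by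
  induction ζ using Ordinal.limitRecOn with
  | zero => rwa [transfiniteIter_zero]
  | add_one ζ ih =>
    rw [transfiniteIter_add_one]
    exact hd _ ih
  | limit ζ hζ ih =>
    rw [transfiniteIter_limit d hζ]
    exact isClosed_iInter fun η => ih η.1 η.2

variable {d : Set α → Set α}

theorem transfiniteIter_antitone (hd : ∀ S, d S ⊆ S) (S : Set α) :
    Antitone fun ζ : Ordinal.{w} => transfiniteIter d ζ S := by
  intro ζ ξ hζξ
  induction ξ using Ordinal.limitRecOn with
  | zero => rw [le_antisymm hζξ zero_le]
  | add_one ξ ih =>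
    rcases hζξ.eq_or_lt with rfl | hlt
    · exact subset_rfl
    · simp only [transfiniteIter_add_one]
      exact (hd _).trans (ih (Order.lt_add_one_iff.1 hlt))
  | limit ξ hξ ih =>
    rcases hζξ.eq_or_lt with rfl | hlt
    · exact subset_rfl
    · simp only [transfiniteIter_limit d hξ]
      exact Set.iInter_subset_of_subset ⟨ζ, hlt⟩ subset_rfl

theorem transfiniteIter_subset (hd : ∀ S, d S ⊆ S) (ζ : Ordinal.{w}) (S : Set α) :
    transfiniteIter d ζ S ⊆ S := by
  simpa only [transfiniteIter_zero] using transfiniteIter_antitone hd S (zero_le (a := ζ))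

theorem iInter_transfiniteIter_subset (hd : ∀ S, d S ⊆ S) {ι : Sort*} {ζ : Ordinal.{w}}
    (hζ : Order.IsSuccLimit ζ) {f : ι → Ordinal.{w}} (hf : ∀ η < ζ, ∃ i, η ≤ f i) (S : Set α) :
    ⋂ i, transfiniteIter d (f i) S ⊆ transfiniteIter d ζ S := by
  rw [transfiniteIter_limit d hζ]
  refine Set.subset_iInter fun η => ?_
  obtain ⟨i, hi⟩ := hf η.1 η.2
  exact Set.iInter_subset_of_subset i (transfiniteIter_antitone hd S hi)

theorem transfiniteIter_add (hd : ∀ S, d S ⊆ S) (ζ η : Ordinal.{w}) (S : Set α) :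
    transfiniteIter d (ζ + η) S = transfiniteIter d η (transfiniteIter d ζ S) := by
  induction η using Ordinal.limitRecOn with
  | zero => rw [add_zero, transfiniteIter_zero]
  | add_one η ih => rw [← add_assoc, transfiniteIter_add_one, ih, transfiniteIter_add_one]
  | limit η hη ih =>
    rw [transfiniteIter_limit d hη, ← Set.iInter_congr fun ρ : Set.Iio η => ih ρ.1 ρ.2]
    refine Set.Subset.antisymm (Set.subset_iInter fun ρ => transfiniteIter_antitone hd S
      (add_le_add_right (Set.mem_Iio.1 ρ.2).le ζ)) ?_
    refine iInter_transfiniteIter_subset hd (Ordinal.isSuccLimit_add ζ hη) (fun ρ hρ => ?_) S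
    have hlt : ρ - ζ < η := Ordinal.sub_lt_of_lt_add hρ hη.bot_lt
    exact ⟨⟨ρ - ζ, hlt⟩, Ordinal.le_add_sub ρ ζ⟩

end TransfiniteIter

section OscDeriv

variable {E F : Type*} [Sub E] [TopologicalSpace E] [Sub F] [TopologicalSpace F]

/-- The derivation `s_ε`, with the diameter of sets measured by `p (y - z)`. In the Szlenk index
`p` is the dual norm, which is only lower semicontinuous for the weak* topology. -/
def oscDeriv (p : E → ℝ) (ε : ℝ) (G : Set E) : Set E :=
  {x | x ∈ G ∧ (0 < ε → ∀ V ∈ 𝓝 x, ∃ y ∈ V ∩ G, ∃ z ∈ V ∩ G, ε < p (y - z))}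

/-- The transfinite derivations `s_ε^ζ`, with the diameter of sets measured by `p (y - z)`. -/
def oscIter (p : E → ℝ) (ε : ℝ) (ζ : Ordinal.{w}) (G : Set E) : Set E :=
  transfiniteIter (oscDeriv p ε) ζ G

/-- The iterated derivations `s_{a 0}^ζ ⋯ s_{a (n - 1)}^ζ(G)`; the one with `a (n - 1)` is applied
first. -/
def oscSeq (p : E → ℝ) (ζ : Ordinal.{w}) : {n : ℕ} → (Fin n → ℝ) → Set E → Set E
  | 0, _, G => G
  | _ + 1, a, G => oscIter p (a 0) ζ (oscSeq p ζ (fun i => a i.succ) G)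

variable {p : E → ℝ} {p' : F → ℝ} {ε ε' : ℝ} {G A : Set E} {B : Set F}

theorem oscDeriv_subset (p : E → ℝ) (ε : ℝ) (G : Set E) : oscDeriv p ε G ⊆ G :=
  fun _ hx => hx.1

theorem oscDeriv_of_nonpos (p : E → ℝ) (hε : ε ≤ 0) (G : Set E) : oscDeriv p ε G = G :=
  (oscDeriv_subset p ε G).antisymm fun _ hx => ⟨hx, fun h => absurd h hε.not_gt⟩

theorem oscDeriv_max_zero (p : E → ℝ) (ε : ℝ) : oscDeriv p (max ε 0) = oscDeriv p ε := by
  rcases le_total ε 0 with h | h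
  · ext1 G
    rw [max_eq_right h, oscDeriv_of_nonpos p h, oscDeriv_of_nonpos p le_rfl]
  · rw [max_eq_left h]

theorem mapsTo_oscDeriv {T : E → F} (hT : Continuous T) {U : Set E} (hU : IsOpen U)
    (hε : 0 < ε' → 0 < ε) (hp : ∀ y z, ε < p (y - z) → ε' < p' (T y - T z))
    (hAB : Set.MapsTo T (A ∩ U) B) : Set.MapsTo T (oscDeriv p ε A ∩ U) (oscDeriv p' ε' B) := by
  rintro x ⟨hx, hxU⟩
  refine ⟨hAB ⟨hx.1, hxU⟩, fun h0 V hV => ?_⟩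
  obtain ⟨y, hy, z, hz, hyz⟩ :=
    hx.2 (hε h0) (T ⁻¹' V ∩ U) (inter_mem (hT.continuousAt hV) (hU.mem_nhds hxU))
  exact ⟨T y, ⟨hy.1.1, hAB ⟨hy.2, hy.1.2⟩⟩, T z, ⟨hz.1.1, hAB ⟨hz.2, hz.1.2⟩⟩, hp y z hyz⟩

theorem oscDeriv_mono {H : Set E} (hGH : G ⊆ H) : oscDeriv p ε G ⊆ oscDeriv p ε H :=
  fun _ hx => ⟨hGH hx.1, fun h0 V hV =>
    have ⟨y, hy, z, hz, hyz⟩ := hx.2 h0 V hV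
    ⟨y, ⟨hy.1, hGH hy.2⟩, z, ⟨hz.1, hGH hz.2⟩, hyz⟩⟩

theorem isClosed_oscDeriv (hG : IsClosed G) : IsClosed (oscDeriv p ε G) := by
  rw [← closure_subset_iff_isClosed]
  intro x hx
  refine ⟨hG.closure_subset_iff.2 (oscDeriv_subset p ε G) hx, fun h0 V hV => ?_⟩
  obtain ⟨U, hUV, hU, hxU⟩ := mem_nhds_iff.1 hV
  obtain ⟨y, hyU, hy⟩ := mem_closure_iff.1 hx U hU hxU
  exact hy.2 h0 V (mem_of_superset (hU.mem_nhds hyU) hUV)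

theorem exists_mem_nhdsWithin_of_notMem_oscDeriv {x : E} (hx : x ∈ G) (h : x ∉ oscDeriv p ε G) :
    ∃ t ∈ 𝓝[G] x, ∀ y ∈ t, ∀ z ∈ t, p (y - z) ≤ ε := by
  simp only [oscDeriv, Set.mem_ofPred_eq, hx, true_and, Classical.not_imp, not_forall, not_exists,
    not_and, not_lt] at h
  obtain ⟨-, V, hV, hle⟩ := h
  exact ⟨V ∩ G, inter_mem (mem_nhdsWithin_of_mem_nhds hV) self_mem_nhdsWithin, hle⟩

theorem oscIter_antitone (p : E → ℝ) (ε : ℝ) (G : Set E) :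
    Antitone fun ζ : Ordinal.{w} => oscIter p ε ζ G :=
  transfiniteIter_antitone (oscDeriv_subset p ε) G

theorem oscIter_subset (p : E → ℝ) (ε : ℝ) (ζ : Ordinal.{w}) (G : Set E) : oscIter p ε ζ G ⊆ G :=
  transfiniteIter_subset (oscDeriv_subset p ε) ζ G

theorem oscIter_one (p : E → ℝ) (ε : ℝ) (G : Set E) :
    oscIter p ε (1 : Ordinal.{w}) G = oscDeriv p ε G :=
  transfiniteIter_one _ G

theorem oscIter_subset_oscDeriv {ζ : Ordinal.{w}} (hζ : 0 < ζ) :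
    oscIter p ε ζ G ⊆ oscDeriv p ε G := by
  simpa only [oscIter_one] using oscIter_antitone p ε G (Order.one_le_iff_pos.2 hζ)

theorem oscIter_of_nonpos (p : E → ℝ) (hε : ε ≤ 0) (ζ : Ordinal.{w}) (G : Set E) :
    oscIter p ε ζ G = G :=
  transfiniteIter_of_fixed (oscDeriv_of_nonpos p hε G) ζ

theorem oscIter_add (p : E → ℝ) (ε : ℝ) (ζ η : Ordinal.{w}) (G : Set E) :
    oscIter p ε (ζ + η) G = oscIter p ε η (oscIter p ε ζ G) :=
  transfiniteIter_add (oscDeriv_subset p ε) ζ η G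

theorem isClosed_oscIter (hG : IsClosed G) (ζ : Ordinal.{w}) : IsClosed (oscIter p ε ζ G) :=
  isClosed_transfiniteIter (fun _ => isClosed_oscDeriv) hG ζ

theorem mapsTo_oscIter_inter {T : E → F} (hT : Continuous T) {U : Set E} (hU : IsOpen U)
    (hε : 0 < ε' → 0 < ε) (hp : ∀ y z, ε < p (y - z) → ε' < p' (T y - T z))
    (hAB : Set.MapsTo T (A ∩ U) B) (ζ : Ordinal.{w}) :
    Set.MapsTo T (oscIter p ε ζ A ∩ U) (oscIter p' ε' ζ B) :=
  mapsTo_transfiniteIter (fun _ _ => mapsTo_oscDeriv hT hU hε hp) hAB ζ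

theorem mapsTo_oscIter {T : E → F} (hT : Continuous T) (hε : 0 < ε' → 0 < ε)
    (hp : ∀ y z, ε < p (y - z) → ε' < p' (T y - T z)) (hAB : Set.MapsTo T A B) (ζ : Ordinal.{w}) :
    Set.MapsTo T (oscIter p ε ζ A) (oscIter p' ε' ζ B) := by
  simpa only [Set.inter_univ] using
    mapsTo_oscIter_inter hT isOpen_univ hε hp (U := Set.univ) (by simpa only [Set.inter_univ]) ζ

theorem oscIter_mono {H : Set E} (hGH : G ⊆ H) (hε : ε' ≤ ε) (ζ : Ordinal.{w}) :
    oscIter p ε ζ G ⊆ oscIter p ε' ζ H :=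
  mapsTo_oscIter continuous_id (fun h => h.trans_le hε) (fun _ _ h => hε.trans_lt h) hGH ζ

theorem oscSeq_subset (p : E → ℝ) (ζ : Ordinal.{w}) {n : ℕ} (a : Fin n → ℝ) (G : Set E) :
    oscSeq p ζ a G ⊆ G := by
  induction n with
  | zero => exact subset_rfl
  | succ n ih => exact (oscIter_subset p _ ζ _).trans (ih _)

theorem oscSeq_mono {H : Set E} (hGH : G ⊆ H) (ζ : Ordinal.{w}) {n : ℕ} (a : Fin n → ℝ) :
    oscSeq p ζ a G ⊆ oscSeq p ζ a H := by
  induction n with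
  | zero => exact hGH
  | succ n ih => exact oscIter_mono (ih _) le_rfl ζ

theorem isClosed_oscSeq (hG : IsClosed G) (ζ : Ordinal.{w}) {n : ℕ} (a : Fin n → ℝ) :
    IsClosed (oscSeq p ζ a G) := by
  induction n with
  | zero => exact hG
  | succ n ih => exact isClosed_oscIter (ih _) ζ

theorem oscSeq_max_zero (p : E → ℝ) (ζ : Ordinal.{w}) {n : ℕ} (a : Fin n → ℝ) (G : Set E) :
    oscSeq p ζ (fun i => max (a i) 0) G = oscSeq p ζ a G := by
  induction n with
  | zero => rfl
  | succ n ih => rw [oscSeq, oscSeq, ih, oscIter, oscDeriv_max_zero, oscIter]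

theorem oscSeq_const (p : E → ℝ) (ζ : Ordinal.{w}) (n : ℕ) (ε : ℝ) (G : Set E) :
    oscSeq p ζ (fun _ : Fin n => ε) G = oscIter p ε (ζ * n) G := by
  induction n with
  | zero => rw [Nat.cast_zero, mul_zero, oscIter, transfiniteIter_zero, oscSeq]
  | succ n ih => rw [oscSeq, ih, ← oscIter_add, Nat.cast_succ, mul_add_one]

theorem oscSeq_subset_oscIter_card (p : E → ℝ) (ζ : Ordinal.{w}) (c : ℝ) {n : ℕ} (a : Fin n → ℝ)
    (G : Set E) :
    oscSeq p ζ a G ⊆ oscIter p c (ζ * (Finset.univ.filter fun i => c ≤ a i).card) G := by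
  induction n with
  | zero => simp only [Finset.univ_eq_empty, Finset.filter_empty, Finset.card_empty, Nat.cast_zero,
      mul_zero, oscIter, transfiniteIter_zero, oscSeq, subset_rfl]
  | succ n ih =>
    rw [Fin.card_filter_univ_succ]
    split_ifs with h0
    · rw [Nat.cast_succ, mul_add_one, oscIter_add]
      exact oscIter_mono (ih fun i => a i.succ) h0 ζ
    · exact (oscIter_subset p _ ζ _).trans (ih fun i => a i.succ)

end OscDeriv

theorem frequently_lt_of_mem_oscDeriv {E : Type*} [AddCommGroup E] [TopologicalSpace E]
    {𝕜 : Type*} [SeminormedRing 𝕜] [Module 𝕜 E] {p : Seminorm 𝕜 E} {ε : ℝ} (hε : 0 < ε) {G : Set E}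
    {x : E} (hx : x ∈ oscDeriv p ε G) : ∃ᶠ y in 𝓝[G] x, ε / 2 < p (y - x) := by
  intro hle
  obtain ⟨V, hV, hVG⟩ := mem_nhdsWithin_iff_exists_mem_nhds_inter.1 hle
  obtain ⟨y, hy, z, hz, hyz⟩ := hx.2 hε V hV
  have hyx : p (y - x) ≤ ε / 2 := not_lt.1 (hVG hy)
  have hzx : p (x - z) ≤ ε / 2 := by
    rw [map_sub_rev]
    exact not_lt.1 (hVG hz)
  have htriangle := map_add_le_add p (y - x) (x - z)
  rw [sub_add_sub_cancel] at htriangle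
  linarith

section Compactness

variable {T E : Type*} [TopologicalSpace T] [TopologicalSpace E] [T2Space E]

theorem eventually_nhdsWithin_image {S : Set T} (hS : IsCompact S) {Ψ : T → E} (hΨ : Continuous Ψ)
    {x : E} {P : E → Prop} (h : ∀ τ ∈ S, Ψ τ = x → ∀ᶠ τ' in 𝓝[S] τ, P (Ψ τ')) :
    ∀ᶠ y in 𝓝[Ψ '' S] x, P y := by
  by_contra hP
  have hfreq : ∃ᶠ y in 𝓝 x, y ∈ Ψ '' S ∧ ¬P y := (frequently_nhdsWithin_iff.1
    (not_eventually.1 hP)).mono fun _ hy => hy.symm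
  have : (comap Ψ (𝓝 x) ⊓ 𝓟 (S ∩ {τ | ¬P (Ψ τ)})).NeBot := by
    refine inf_principal_neBot_iff.2 fun A hA => ?_
    obtain ⟨B, hB, hBA⟩ := hA
    obtain ⟨_, ⟨⟨τ, hτ, rfl⟩, hPτ⟩, hτB⟩ := (hfreq.and_eventually hB).exists
    exact ⟨τ, hBA hτB, hτ, hPτ⟩
  obtain ⟨τ, hτ, hcluster⟩ := hS (inf_le_right.trans (principal_mono.2 Set.inter_subset_left) :
    comap Ψ (𝓝 x) ⊓ 𝓟 (S ∩ {τ | ¬P (Ψ τ)}) ≤ 𝓟 S)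
  have hΨτ : Ψ τ = x := by
    have hmap : ClusterPt (Ψ τ) (𝓝 x) := hcluster.map hΨ.continuousAt
      (tendsto_comap.mono_left inf_le_left)
    exact eq_of_nhds_neBot hmap
  have hτfreq : ∃ᶠ τ' in 𝓝 τ, τ' ∈ S ∧ ¬P (Ψ τ') := by
    have hne : ClusterPt τ (𝓟 (S ∩ {τ | ¬P (Ψ τ)})) := hcluster.mono inf_le_right
    exact frequently_mem_iff_neBot.2 hne
  obtain ⟨τ', ⟨hτ'S, hτ'P⟩, hτ'⟩ :=
    (hτfreq.and_eventually (eventually_nhdsWithin_iff.1 (h τ hτ hΨτ))).exists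
  exact hτ'P (hτ' hτ'S)

theorem iInter_image_subset_image_iInter {ι : Type*} [Nonempty ι] [Preorder ι] [IsDirectedOrder ι]
    [T2Space T] {D : ι → Set T} (hD : Antitone D) (hc : ∀ i, IsCompact (D i)) {Ψ : T → E}
    (hΨ : Continuous Ψ) : ⋂ i, Ψ '' D i ⊆ Ψ '' ⋂ i, D i := by
  intro x hx
  have hfib : IsClosed (Ψ ⁻¹' {x}) := isClosed_singleton.preimage hΨ
  obtain ⟨τ, hτ⟩ := IsCompact.nonempty_iInter_of_directed_nonempty_isCompact_isClosed
    (fun i => D i ∩ Ψ ⁻¹' {x})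
    (directed_of_isDirected_le fun i j hij => Set.inter_subset_inter_left _ (hD hij))
    (fun i => (Set.mem_iInter.1 hx i).imp fun _ h => h)
    (fun i => (hc i).inter_right hfib) fun i => (hc i).isClosed.inter hfib
  rw [Set.mem_iInter] at hτ
  exact ⟨τ, Set.mem_iInter.2 fun i => (hτ i).1, (hτ (Classical.arbitrary ι)).2⟩

end Compactness

section ClosedConvexHull

variable {E F : Type*} [AddCommGroup E] [Module ℝ E] [TopologicalSpace E]
  [AddCommGroup F] [Module ℝ F] [TopologicalSpace F]

theorem mapsTo_closedConvexHull (T : E →L[ℝ] F) {A : Set E} {B : Set F} (hT : Set.MapsTo T A B) :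
    Set.MapsTo T (closedConvexHull ℝ A) (closedConvexHull ℝ B) :=
  closedConvexHull_min (fun _ hx => subset_closedConvexHull (hT hx))
    (convex_closedConvexHull.linear_preimage T.toLinearMap)
    (isClosed_closedConvexHull.preimage T.continuous)

theorem closedConvexHull_subset_setOf_le (f : E →L[ℝ] ℝ) {A : Set E} {c : ℝ}
    (h : ∀ x ∈ A, f x ≤ c) : ∀ x ∈ closedConvexHull ℝ A, f x ≤ c :=
  closedConvexHull_min h (convex_halfSpace_le f.toLinearMap.isLinear c)
    (isClosed_le f.continuous continuous_const)

variable [IsTopologicalAddGroup E]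

theorem seminorm_sub_le_of_mem_closedConvexHull {p : Seminorm ℝ E} (hp : LowerSemicontinuous p)
    {G : Set E} {d : ℝ} (h : ∀ y ∈ G, ∀ z ∈ G, p (y - z) ≤ d) :
    ∀ y ∈ closedConvexHull ℝ G, ∀ z ∈ closedConvexHull ℝ G, p (y - z) ≤ d := by
  have hball (z : E) (hz : ∀ y ∈ G, p (y - z) ≤ d) :
      ∀ y ∈ closedConvexHull ℝ G, p (y - z) ≤ d := by
    refine closedConvexHull_min (t := {y | p (y - z) ≤ d}) hz ?_
      ((hp.isClosed_preimage d).preimage (continuous_sub_right z))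
    have : {y | p (y - z) ≤ d} = p.closedBall z d := Set.ext fun y => p.mem_closedBall.symm
    rw [this]
    exact p.convex_closedBall z d
  intro y hy z hz
  refine hball z (fun y' hy' => ?_) y hy
  rw [map_sub_rev]
  exact hball y' (fun z' hz' => h z' hz' y' hy') z hz

variable [ContinuousSMul ℝ E]

theorem closedConvexHull_union_subset [T2Space E] {A B : Set E}
    (hA : IsCompact (closedConvexHull ℝ A)) (hB : IsCompact (closedConvexHull ℝ B))
    (hA' : A.Nonempty) (hB' : B.Nonempty) :
    closedConvexHull ℝ (A ∪ B) ⊆ (fun τ : ℝ × E × E => (1 - τ.1) • τ.2.1 + τ.1 • τ.2.2) ''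
      (Set.Icc 0 1 ×ˢ closedConvexHull ℝ A ×ˢ closedConvexHull ℝ B) := by
  rw [closedConvexHull_eq_closure_convexHull]
  refine closure_minimal ?_ ((isCompact_Icc.prod (hA.prod hB)).image (by fun_prop)).isClosed
  rw [convexHull_union hA' hB']
  intro x hx
  obtain ⟨a, ha, b, hb, hx⟩ := mem_convexJoin.1 hx
  rw [segment_eq_image] at hx
  obtain ⟨θ, hθ, rfl⟩ := hx
  exact ⟨(θ, a, b), ⟨hθ, convexHull_subset_closedConvexHull ha,
    convexHull_subset_closedConvexHull hb⟩, rfl⟩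

variable [LocallyConvexSpace ℝ E]

theorem exists_affine_of_notMem_closedConvexHull {A : Set (E × ℝ)} {q : E} {b₀ b : ℝ}
    (hb : (q, b) ∉ closedConvexHull ℝ A) (hb₀ : (q, b₀) ∈ closedConvexHull ℝ A) (hle : b₀ ≤ b) :
    ∃ (f : E →L[ℝ] ℝ) (α : ℝ), (∀ x ∈ A, x.2 < f x.1 + α) ∧ f q + α < b := by
  obtain ⟨F, s, hs, hsq⟩ := geometric_hahn_banach_closed_point convex_closedConvexHull
    isClosed_closedConvexHull hb
  have hF (e : E) (c : ℝ) : F (e, c) = F (e, 0) + c * F (0, 1) := by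
    rw [← smul_eq_mul, ← map_smul, ← map_add]
    simp
  have hslope : 0 < F (0, 1) := by
    have hlt := (hs _ hb₀).trans hsq
    rw [hF q b₀, hF q b] at hlt
    nlinarith
  have hval (e : E) : (-(F (0, 1))⁻¹ • F.comp (ContinuousLinearMap.inl ℝ E ℝ)) e +
      (F (0, 1))⁻¹ * s = (s - F (e, 0)) / F (0, 1) := by
    simp
    ring
  refine ⟨-(F (0, 1))⁻¹ • F.comp (ContinuousLinearMap.inl ℝ E ℝ), (F (0, 1))⁻¹ * s,
    fun x hx => ?_, ?_⟩
  · have hx' := hs x (subset_closedConvexHull hx)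
    rw [← Prod.mk.eta (p := x), hF] at hx'
    rw [hval, lt_div_iff₀ hslope]
    linarith
  · rw [hF] at hsq
    rw [hval, div_lt_iff₀ hslope]
    linarith

theorem iInter_closedConvexHull_subset [T2Space E] {ι : Type*} [Nonempty ι] [Preorder ι]
    [IsDirectedOrder ι] {D : ι → Set E} (hD : Antitone D) (hc : ∀ i, IsCompact (D i)) :
    ⋂ i, closedConvexHull ℝ (D i) ⊆ closedConvexHull ℝ (⋂ i, D i) := by
  intro x hx
  by_contra hx'
  obtain ⟨f, s, hs, hsx⟩ := geometric_hahn_banach_closed_point convex_closedConvexHull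
    isClosed_closedConvexHull hx'
  have hcl : IsClosed {y | s ≤ f y} := isClosed_le continuous_const f.continuous
  have hne (i : ι) : (D i ∩ {y | s ≤ f y}).Nonempty := by
    by_contra hempty
    refine hsx.not_ge (closedConvexHull_subset_setOf_le f (fun y hy => ?_) x
      (Set.mem_iInter.1 hx i))
    exact le_of_not_ge fun hsy => hempty ⟨y, hy, hsy⟩
  obtain ⟨y, hy⟩ := IsCompact.nonempty_iInter_of_directed_nonempty_isCompact_isClosed
    (fun i => D i ∩ {y | s ≤ f y})
    (directed_of_isDirected_le fun i j hij => Set.inter_subset_inter_left _ (hD hij)) hne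
    (fun i => (hc i).inter_right hcl) fun i => (hc i).isClosed.inter hcl
  rw [Set.mem_iInter] at hy
  exact (hs y (subset_closedConvexHull (Set.mem_iInter.2 fun i => (hy i).1))).not_ge
    (hy (Classical.arbitrary ι)).2

end ClosedConvexHull

section PointOscillation

/-- The pointwise oscillation of the set `C` is at most `h`: near every `q ∈ C`, the points of `C`
have `p`-distance at most `h q` (up to an arbitrarily small error) from `q`. -/
def PointOscLE {E : Type*} [Sub E] [TopologicalSpace E] (p : E → ℝ) (C : Set E) (h : E → ℝ) :
    Prop :=
  ∀ q ∈ C, ∀ η > 0, ∀ᶠ q' in 𝓝[C] q, p (q' - q) ≤ h q + η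

theorem PointOscLE.mono {E : Type*} [Sub E] [TopologicalSpace E] {p : E → ℝ} {C C' : Set E}
    {h : E → ℝ} (hC : PointOscLE p C h) (hsub : C' ⊆ C) : PointOscLE p C' h :=
  fun q hq η hη => (hC q (hsub hq) η hη).filter_mono (nhdsWithin_mono q hsub)

variable {E : Type*} [AddCommGroup E] [Module ℝ E] [TopologicalSpace E] [IsTopologicalAddGroup E]
  {p : Seminorm ℝ E} {h : E → ℝ}

theorem pointOscLE_closedConvexHull_of_diam_le (hp : LowerSemicontinuous p)
    (hh : ConcaveOn ℝ Set.univ h) (hcont : Continuous h) {A : Set E} {d : ℝ}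
    (hd : ∀ y ∈ A, ∀ z ∈ A, p (y - z) ≤ d) (hdh : ∀ y ∈ A, d ≤ h y) :
    PointOscLE p (closedConvexHull ℝ A) h := by
  intro q hq η hη
  have hdq : d ≤ h q := by
    refine closedConvexHull_min (t := {y | d ≤ h y}) hdh ?_ (isClosed_le continuous_const hcont) hq
    simpa only [Set.mem_univ, true_and] using hh.convex_ge d
  filter_upwards [self_mem_nhdsWithin] with q' hq'
  exact (seminorm_sub_le_of_mem_closedConvexHull hp hd q' hq' q hq).trans (by linarith)

variable [ContinuousSMul ℝ E] [T2Space E]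

theorem PointOscLE.join {A B : Set E} (hA : IsCompact A) (hB : IsCompact B) {R : ℝ}
    (hR : ∀ a ∈ A, ∀ b ∈ B, p (b - a) ≤ R) (hh : ConcaveOn ℝ Set.univ h)
    (hpA : PointOscLE p A h) (hpB : PointOscLE p B h) :
    PointOscLE p ((fun τ : ℝ × E × E => (1 - τ.1) • τ.2.1 + τ.1 • τ.2.2) ''
      (Set.Icc 0 1 ×ˢ A ×ˢ B)) h := by
  rintro q - η hη
  refine eventually_nhdsWithin_image (P := fun q' => p (q' - q) ≤ h q + η)
    (isCompact_Icc.prod (hA.prod hB)) (by fun_prop) ?_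
  rintro ⟨θ, a, b⟩ ⟨hθ, ha, hb⟩ rfl
  have hsmall : ∀ᶠ θ' in 𝓝[Set.Icc 0 1] θ, |θ' - θ| * R < η / 2 := by
    have hcont : Continuous fun θ' : ℝ => |θ' - θ| * R := by fun_prop
    refine nhdsWithin_le_nhds (hcont.tendsto θ (gt_mem_nhds ?_))
    simpa using hη
  rw [nhdsWithin_prod_eq, nhdsWithin_prod_eq]
  filter_upwards [hsmall.prod_mk (((hpA a ha _ (half_pos hη)).and self_mem_nhdsWithin).prod_mk
    ((hpB b hb _ (half_pos hη)).and self_mem_nhdsWithin))]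
  rintro ⟨θ', a', b'⟩ ⟨hθ', ⟨ha', ha'A⟩, hb', hb'B⟩
  have hθ0 : 0 ≤ θ := hθ.1
  have hθ1 : 0 ≤ 1 - θ := sub_nonneg.2 hθ.2
  have hconcave : (1 - θ) * h a + θ * h b ≤ h ((1 - θ) • a + θ • b) :=
    hh.2 (Set.mem_univ a) (Set.mem_univ b) hθ1 hθ0 (sub_add_cancel 1 θ)
  have hdec : (1 - θ') • a' + θ' • b' - ((1 - θ) • a + θ • b) =
      (1 - θ) • (a' - a) + θ • (b' - b) + (θ' - θ) • (b' - a') := by module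
  calc p ((1 - θ') • a' + θ' • b' - ((1 - θ) • a + θ • b))
      ≤ (1 - θ) * p (a' - a) + θ * p (b' - b) + |θ' - θ| * p (b' - a') := by
        rw [hdec]
        refine (map_add_le_add p _ _).trans (add_le_add ((map_add_le_add p _ _).trans_eq ?_) ?_)
        · simp only [map_smul_eq_mul, Real.norm_of_nonneg hθ0, Real.norm_of_nonneg hθ1]
        · rw [map_smul_eq_mul, Real.norm_eq_abs]
    _ ≤ (1 - θ) * (h a + η / 2) + θ * (h b + η / 2) + |θ' - θ| * R := by
        gcongr
        exact hR a' ha'A b' hb'B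
    _ ≤ h ((1 - θ) • a + θ • b) + η := by linarith

theorem pointOscLE_closedConvexHull_union (hp : LowerSemicontinuous p)
    (hh : ConcaveOn ℝ Set.univ h) {A B G : Set E} (hAG : A ⊆ G) (hBG : B ⊆ G)
    (hG : IsCompact (closedConvexHull ℝ G)) {R : ℝ} (hR : ∀ y ∈ G, ∀ z ∈ G, p (y - z) ≤ R)
    (hA : PointOscLE p (closedConvexHull ℝ A) h) (hB : PointOscLE p (closedConvexHull ℝ B) h) :
    PointOscLE p (closedConvexHull ℝ (A ∪ B)) h := by
  rcases A.eq_empty_or_nonempty with rfl | hA'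
  · rwa [Set.empty_union]
  rcases B.eq_empty_or_nonempty with rfl | hB'
  · rwa [Set.union_empty]
  have hAG := (closedConvexHull ℝ).monotone hAG
  have hBG := (closedConvexHull ℝ).monotone hBG
  have hAc := hG.of_isClosed_subset isClosed_closedConvexHull hAG
  have hBc := hG.of_isClosed_subset isClosed_closedConvexHull hBG
  have hR' := seminorm_sub_le_of_mem_closedConvexHull hp hR
  exact (PointOscLE.join hAc hBc (fun a ha b hb => hR' b (hBG hb) a (hAG ha)) hh hA hB).mono
    (closedConvexHull_union_subset hAc hBc hA' hB')

theorem pointOscLE_closedConvexHull (hp : LowerSemicontinuous p) (hh : ConcaveOn ℝ Set.univ h)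
    (hcont : Continuous h) {G : Set E} (hG : IsCompact G) (hC : IsCompact (closedConvexHull ℝ G))
    {R : ℝ} (hR : ∀ y ∈ G, ∀ z ∈ G, p (y - z) ≤ R)
    (hloc : ∀ g ∈ G, ∃ t ∈ 𝓝[G] g, ∀ y ∈ t, ∀ z ∈ t, p (y - z) ≤ h g) :
    PointOscLE p (closedConvexHull ℝ G) h := by
  suffices key : ∀ κ > 0, PointOscLE p (closedConvexHull ℝ G) fun x => h x + κ by
    intro q hq η hη
    filter_upwards [key (η / 2) (half_pos hη) q hq (η / 2) (half_pos hη)] with q' hq'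
    linarith
  intro κ hκ
  have hhκ : ConcaveOn ℝ Set.univ fun x => h x + κ := hh.add_const κ
  suffices PointOscLE p (closedConvexHull ℝ (G ∩ G)) fun x => h x + κ by
    rwa [Set.inter_self] at this
  refine hG.induction_on
    (p := fun s => PointOscLE p (closedConvexHull ℝ (s ∩ G)) fun x => h x + κ) ?_ ?_ ?_ ?_
  · intro q hq
    simp [closedConvexHull_eq_closure_convexHull] at hq
  · exact fun s t hst ht => ht.mono ((closedConvexHull ℝ).monotone
      (Set.inter_subset_inter_left G hst))
  · intro s t hs ht
    rw [Set.union_inter_distrib_right]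
    exact pointOscLE_closedConvexHull_union hp hhκ Set.inter_subset_right Set.inter_subset_right
      hC hR hs ht
  · intro g hg
    obtain ⟨t, ht, hdiam⟩ := hloc g hg
    have hnear : {y | h g - κ < h y} ∈ 𝓝[G] g :=
      nhdsWithin_le_nhds (hcont.continuousAt.eventually (lt_mem_nhds (by linarith)))
    refine ⟨t ∩ {y | h g - κ < h y}, inter_mem ht hnear,
      pointOscLE_closedConvexHull_of_diam_le hp hhκ (by fun_prop)
        (fun y hy z hz => hdiam y hy.1.1 z hz.1.1) fun y hy => ?_⟩
    have hgy : h g - κ < h y := hy.1.2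
    linarith

end PointOscillation

section SurvivalGraph

variable {E : Type*} [AddCommGroup E] [Module ℝ E] [TopologicalSpace E] {p : Seminorm ℝ E}
  {ζ : Ordinal.{w}} {δ R : ℝ} {G : Set E}

/-- The points `(g, b)` with `g ∈ G` and `0 ≤ b ≤ R` such that `g` survives the derivations
`s_c^ζ(G)` for all `c < b - δ`. Its closed convex hull records how the derivations of `G` average
out over the closed convex hull of `G`. -/
def survivalGraph (p : Seminorm ℝ E) (ζ : Ordinal.{w}) (δ R : ℝ) (G : Set E) : Set (E × ℝ) :=
  {x | x.1 ∈ G ∧ x.2 ∈ Set.Icc 0 R ∧ ∀ c, c + δ < x.2 → x.1 ∈ oscIter p c ζ G}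

/-- The analogue of `survivalGraph` for sequences of derivations: the points `(g, b)` with `g ∈ G`
and `0 ≤ b i ≤ R` such that `g` survives the derivations `oscSeq p ζ c G` whenever `c i < b i` for
all `i`. -/
def survivalSeqGraph (p : Seminorm ℝ E) (ζ : Ordinal.{w}) (R : ℝ) (G : Set E) (n : ℕ) :
    Set (E × (Fin n → ℝ)) :=
  {x | x.1 ∈ G ∧ x.2 ∈ Set.Icc 0 (fun _ => R) ∧
    ∀ c : Fin n → ℝ, (∀ i, c i < x.2 i) → x.1 ∈ oscSeq p ζ c G}

theorem survivalGraph_anti {ζ' : Ordinal.{w}} {δ' : ℝ} (hζ : ζ ≤ ζ') (hδ : δ' ≤ δ) :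
    survivalGraph p ζ' δ' R G ⊆ survivalGraph p ζ δ R G :=
  fun _ hx => ⟨hx.1, hx.2.1, fun c hc =>
    oscIter_antitone p c G hζ (hx.2.2 c ((add_le_add_right hδ c).trans_lt hc))⟩

theorem iInter_survivalGraph_subset {ι : Type*} [Nonempty ι] (hζ : Order.IsSuccLimit ζ)
    {f : ι → Ordinal.{w}} {δ : ι → ℝ} (h : ∀ η < ζ, ∀ κ > 0, ∃ i, η ≤ f i ∧ δ i < κ) :
    ⋂ i, survivalGraph p (f i) (δ i) R G ⊆ survivalGraph p ζ 0 R G := by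
  intro x hx
  rw [Set.mem_iInter] at hx
  refine ⟨(hx (Classical.arbitrary ι)).1, (hx (Classical.arbitrary ι)).2.1, fun c hc => ?_⟩
  rw [add_zero] at hc
  refine iInter_transfiniteIter_subset (oscDeriv_subset p c) hζ
    (f := fun i : {i // δ i < x.2 - c} => f i) (fun η hη => ?_) G
    (Set.mem_iInter.2 fun i => (hx i).2.2 c (by linarith [i.2]))
  obtain ⟨i, hi, hδi⟩ := h η hη (x.2 - c) (sub_pos.2 hc)
  exact ⟨⟨i, hδi⟩, hi⟩

theorem mk_zero_mem_survivalGraph (hδ : 0 ≤ δ) (hR : 0 ≤ R) {g : E} (hg : g ∈ G) :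
    (g, (0 : ℝ)) ∈ survivalGraph p ζ δ R G := by
  refine ⟨hg, ⟨le_rfl, hR⟩, fun c hc => ?_⟩
  dsimp only at hc ⊢
  rwa [oscIter_of_nonpos p (by linarith)]

theorem isOpen_setOf_forall_lt {n : ℕ} (c : Fin n → ℝ) :
    IsOpen {b : Fin n → ℝ | ∀ i, c i < b i} := by
  simpa only [Set.ofPred_forall] using isOpen_iInter_of_finite fun i =>
    isOpen_lt continuous_const (continuous_apply i)

theorem cons_mem_survivalSeqGraph {n : ℕ} {g : E} {b : Fin n → ℝ} {β : ℝ}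
    (h : ((g, b), β) ∈ survivalGraph (p.comp (LinearMap.fst ℝ E (Fin n → ℝ))) ζ 0 R
      (survivalSeqGraph p ζ R G n)) :
    (g, (Fin.cons β b : Fin (n + 1) → ℝ)) ∈ survivalSeqGraph p ζ R G (n + 1) := by
  obtain ⟨⟨hg, hb, -⟩, hβ, hsurvives⟩ := h
  refine ⟨hg, ⟨Fin.cases hβ.1 hb.1, Fin.cases hβ.2 hb.2⟩, fun c hc => ?_⟩
  have hc0 : c 0 + 0 < β := by rw [add_zero]; exact hc 0
  exact mapsTo_oscIter_inter (p' := p) continuous_fst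
    ((isOpen_setOf_forall_lt fun i => c i.succ).preimage continuous_snd) id (fun _ _ => id)
    (fun y hy => hy.1.2.2 _ hy.2) ζ ⟨hsurvives (c 0) hc0, fun i => hc i.succ⟩

theorem average_mem_survivalGraph {n m : ℕ} (hn : 0 < n) (hm : m * R < n * δ) {g : E}
    {b : Fin n → ℝ} (h : (g, b) ∈ survivalSeqGraph p ζ R G n) :
    (g, (n : ℝ)⁻¹ * ∑ i, b i) ∈ survivalGraph p (ζ * m) δ R G := by
  obtain ⟨hg, ⟨hb0, hbR⟩, hsurvives⟩ := h
  have hn' : (0 : ℝ) < n := Nat.cast_pos.2 hn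
  have hR : 0 ≤ R := (hb0 ⟨0, hn⟩).trans (hbR ⟨0, hn⟩)
  have hsumR : ∑ i, b i ≤ n * R := by
    simpa using Finset.sum_le_card_nsmul Finset.univ b R fun i _ => hbR i
  refine ⟨hg, ⟨mul_nonneg (inv_nonneg.2 hn'.le) (Finset.sum_nonneg fun i _ => hb0 i),
    (inv_mul_le_iff₀ hn').2 hsumR⟩, fun c hc => ?_⟩
  rcases le_or_gt c 0 with hc0 | hc0
  · rwa [oscIter_of_nonpos p hc0]
  rw [lt_inv_mul_iff₀ hn'] at hc
  set I := Finset.univ.filter fun i => c < b i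
  have hsum : ∑ i, b i ≤ I.card * R + n * c := by
    calc ∑ i, b i ≤ ∑ i, ((if c < b i then R else 0) + c) := by
          refine Finset.sum_le_sum fun i _ => ?_
          split_ifs with hi
          · exact (hbR i).trans (le_add_of_nonneg_right hc0.le)
          · linarith
      _ = I.card * R + n * c := by
          rw [Finset.sum_add_distrib, ← Finset.sum_filter]
          simp [I]
  -- Among numbers `b i ≤ R` with average greater than `c + δ`, at least `m` exceed `c`.
  have hmI : m ≤ I.card := by
    have hlt : m * R < I.card * R := by linarith
    exact_mod_cast (lt_of_mul_lt_mul_right hlt hR).le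
  have hmem := hsurvives (fun i => if c < b i then c else b i - 1) fun i => by
    split_ifs with hi
    · exact hi
    · exact sub_one_lt _
  refine oscIter_antitone p c G ?_ (oscSeq_subset_oscIter_card p ζ c _ G hmem)
  gcongr
  refine hmI.trans (Finset.card_le_card fun i hi => ?_)
  have hci : c < b i := (Finset.mem_filter.1 hi).2
  simp only [Finset.mem_filter, Finset.mem_univ, hci, if_true, le_rfl, and_self]

theorem isCompact_survivalGraph [T2Space E] (hG : IsCompact G) :
    IsCompact (survivalGraph p ζ δ R G) := by
  refine (hG.prod (isCompact_Icc (a := 0) (b := R))).of_isClosed_subset ?_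
    fun x hx => ⟨hx.1, hx.2.1⟩
  have hsurvives : IsClosed {x : E × ℝ | ∀ c, c + δ < x.2 → x.1 ∈ oscIter p c ζ G} := by
    rw [Set.ofPred_forall]
    exact isClosed_iInter fun c => isClosed_imp (isOpen_lt continuous_const continuous_snd)
      ((isClosed_oscIter hG.isClosed ζ).preimage continuous_fst)
  exact (hG.isClosed.preimage continuous_fst).inter
    ((isClosed_Icc.preimage continuous_snd).inter hsurvives)

theorem isCompact_survivalSeqGraph [T2Space E] (hG : IsCompact G) (n : ℕ) :
    IsCompact (survivalSeqGraph p ζ R G n) := by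
  refine (hG.prod (isCompact_Icc (a := 0) (b := fun _ => R))).of_isClosed_subset ?_
    fun x hx => ⟨hx.1, hx.2.1⟩
  have hsurvives : IsClosed {x : E × (Fin n → ℝ) |
      ∀ c : Fin n → ℝ, (∀ i, c i < x.2 i) → x.1 ∈ oscSeq p ζ c G} := by
    rw [Set.ofPred_forall]
    exact isClosed_iInter fun c =>
      isClosed_imp ((isOpen_setOf_forall_lt c).preimage continuous_snd)
        ((isClosed_oscSeq hG.isClosed ζ c).preimage continuous_fst)
  exact (hG.isClosed.preimage continuous_fst).inter
    ((isClosed_Icc.preimage continuous_snd).inter hsurvives)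

theorem isCompact_closedConvexHull_survivalSeqGraph (hC : IsCompact (closedConvexHull ℝ G))
    (n : ℕ) : IsCompact (closedConvexHull ℝ (survivalSeqGraph p ζ R G n)) := by
  refine (hC.prod (isCompact_Icc (a := 0) (b := fun _ => R))).of_isClosed_subset
    isClosed_closedConvexHull (closedConvexHull_min
      (fun x hx => ⟨subset_closedConvexHull hx.1, hx.2.1⟩)
      (convex_closedConvexHull.prod (convex_Icc _ _))
      (isClosed_closedConvexHull.prod isClosed_Icc))

end SurvivalGraph

section Transfer

variable {E : Type v} [AddCommGroup E] [Module ℝ E] [TopologicalSpace E] [IsTopologicalAddGroup E]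
  [ContinuousSMul ℝ E] [LocallyConvexSpace ℝ E] [T2Space E] {p : Seminorm ℝ E} {ζ : Ordinal.{w}}
  {G : Set E} {R : ℝ}

/-- The derivations `s_ε^ζ` of closed convex hulls are controlled by those of the sets themselves:
each `q ∈ s_ε^ζ(C)`, where `C` is the closed convex hull of `G`, is an average of points of `G`
weighted by how long they survive, with mean survival level `ε / 2`. All spaces are quantified over,
since the induction passes to products with `ℝⁿ`. -/
def TransfersDeriv (ζ : Ordinal.{w}) : Prop :=
  ∀ (E : Type v) [AddCommGroup E] [Module ℝ E] [TopologicalSpace E] [IsTopologicalAddGroup E]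
    [ContinuousSMul ℝ E] [LocallyConvexSpace ℝ E] [T2Space E] (p : Seminorm ℝ E) (G : Set E)
    (R ε : ℝ), LowerSemicontinuous p → IsCompact G → IsCompact (closedConvexHull ℝ G) →
    (∀ y ∈ G, ∀ z ∈ G, p (y - z) ≤ R) → 0 ≤ ε → ∀ q ∈ oscIter p ε ζ (closedConvexHull ℝ G),
      (q, ε / 2) ∈ closedConvexHull ℝ (survivalGraph p ζ 0 R G)

theorem transfersDeriv_one : TransfersDeriv.{v} (1 : Ordinal.{w}) := by
  intro E _ _ _ _ _ _ _ p G R ε hp hG hC hR hε q hq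
  rw [oscIter_one] at hq
  have hR0 {g : E} (hg : g ∈ G) : 0 ≤ R := (apply_nonneg p _).trans (hR g hg g hg)
  have hq0 : (q, (0 : ℝ)) ∈ closedConvexHull ℝ (survivalGraph p (1 : Ordinal.{w}) 0 R G) :=
    mapsTo_closedConvexHull (ContinuousLinearMap.inl ℝ E ℝ)
      (fun g hg => mk_zero_mem_survivalGraph le_rfl (hR0 hg) hg) hq.1
  rcases hε.eq_or_lt with rfl | hε0
  · rwa [zero_div]
  by_contra hq'
  obtain ⟨f, α, hf, hfq⟩ := exists_affine_of_notMem_closedConvexHull hq' hq0 (half_pos hε0).le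
  have hconc : ConcaveOn ℝ Set.univ fun x => f x + α :=
    (f.toLinearMap.concaveOn convex_univ).add_const α
  have hloc : ∀ g ∈ G, ∃ t ∈ 𝓝[G] g, ∀ y ∈ t, ∀ z ∈ t, p (y - z) ≤ f g + α := by
    intro g hg
    have hpos : 0 < f g + α := hf _ (mk_zero_mem_survivalGraph le_rfl (hR0 hg) hg)
    rcases le_or_gt R (f g + α) with hRh | hRh
    · exact ⟨G, self_mem_nhdsWithin, fun y hy z hz => (hR y hy z hz).trans hRh⟩
    have hdies : ∃ c < f g + α, g ∉ oscIter p c (1 : Ordinal.{w}) G := by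
      by_contra! hsurvives
      exact lt_irrefl _ (hf (g, f g + α) ⟨hg, ⟨hpos.le, hRh.le⟩, fun c hc =>
        hsurvives c (by rwa [add_zero] at hc)⟩)
    obtain ⟨c, hc, hgc⟩ := hdies
    rw [oscIter_one] at hgc
    obtain ⟨t, ht, hdiam⟩ := exists_mem_nhdsWithin_of_notMem_oscDeriv hg hgc
    exact ⟨t, ht, fun y hy z hz => (hdiam y hy z hz).trans hc.le⟩
  have hosc := pointOscLE_closedConvexHull hp hconc (by fun_prop) hG hC hR hloc q hq.1
    (ε / 2 - (f q + α)) (sub_pos.2 hfq)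
  rw [add_sub_cancel] at hosc
  obtain ⟨q', hlt, hle⟩ := ((frequently_lt_of_mem_oscDeriv hε0 hq).and_eventually hosc).exists
  exact hlt.not_ge hle

theorem mem_closedConvexHull_survivalGraph_of_limit (hG : IsCompact G)
    (hζ : Order.IsSuccLimit ζ) {ι : Type*} [Nonempty ι] [Preorder ι] [IsDirectedOrder ι]
    {f : ι → Ordinal.{w}} {δ : ι → ℝ} (hf : Monotone f) (hδ : Antitone δ)
    (hcofinal : ∀ η < ζ, ∀ κ > 0, ∃ i, η ≤ f i ∧ δ i < κ) {x : E × ℝ}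
    (hx : ∀ i, x ∈ closedConvexHull ℝ (survivalGraph p (f i) (δ i) R G)) :
    x ∈ closedConvexHull ℝ (survivalGraph p ζ 0 R G) :=
  (closedConvexHull ℝ).monotone (iInter_survivalGraph_subset hζ hcofinal) <|
    iInter_closedConvexHull_subset (fun _ _ hij => survivalGraph_anti (hf hij) (hδ hij))
      (fun _ => isCompact_survivalGraph hG) (Set.mem_iInter.2 hx)

theorem TransfersDeriv.seq (h : TransfersDeriv.{v} ζ) (hp : LowerSemicontinuous p)
    (hG : IsCompact G) (hC : IsCompact (closedConvexHull ℝ G))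
    (hR : ∀ y ∈ G, ∀ z ∈ G, p (y - z) ≤ R) {n : ℕ} {a : Fin n → ℝ} (ha : ∀ i, 0 ≤ a i) {q : E}
    (hq : q ∈ oscSeq p ζ a (closedConvexHull ℝ G)) :
    (q, fun i => a i / 2) ∈ closedConvexHull ℝ (survivalSeqGraph p ζ R G n) := by
  induction n generalizing q with
  | zero =>
    rw [Subsingleton.elim (fun i => a i / 2) 0]
    exact mapsTo_closedConvexHull (ContinuousLinearMap.inl ℝ E (Fin 0 → ℝ))
      (B := survivalSeqGraph p ζ R G 0)
      (fun g hg => ⟨hg, ⟨le_rfl, fun i => i.elim0⟩, fun _ _ => hg⟩) hq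
  | succ n ih =>
    set t : Fin n → ℝ := fun i => a i.succ / 2
    set p' := p.comp (LinearMap.fst ℝ E (Fin n → ℝ))
    have hqt : (q, t) ∈ oscIter p' (a 0) ζ (closedConvexHull ℝ (survivalSeqGraph p ζ R G n)) :=
      mapsTo_oscIter (T := fun x => (x, t)) (by fun_prop) id (fun _ _ => id)
        (fun x hx => ih (fun i => ha i.succ) hx) ζ hq
    have hmem := h _ p' _ R (a 0) (hp.comp continuous_fst) (isCompact_survivalSeqGraph hG n)
      (isCompact_closedConvexHull_survivalSeqGraph hC n)
      (fun y hy z hz => hR y.1 hy.1 z.1 hz.1) (ha 0) _ hqt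
    let cons : (E × (Fin n → ℝ)) × ℝ →L[ℝ] E × (Fin (n + 1) → ℝ) :=
      (ContinuousLinearMap.fst ℝ E _ ∘L ContinuousLinearMap.fst ℝ _ ℝ).prod
        ((ContinuousLinearMap.snd ℝ _ ℝ).finCons
          (ContinuousLinearMap.snd ℝ E _ ∘L ContinuousLinearMap.fst ℝ _ ℝ))
    have hcons := mapsTo_closedConvexHull cons
      (fun _ hx => cons_mem_survivalSeqGraph hx) hmem
    rwa [show (fun i => a i / 2) = Fin.cons (a 0 / 2) t from
      funext (Fin.cases rfl fun _ => rfl)]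

theorem TransfersDeriv.mul_omega0 (h : TransfersDeriv.{v} ζ) (hζ : 0 < ζ) :
    TransfersDeriv.{v} (ζ * Ordinal.omega0) := by
  intro E _ _ _ _ _ _ _ p G R ε hp hG hC hR hε q hq
  have hanti : Antitone fun m : ℕ => 1 / ((m : ℝ) + 1) := fun _ _ => Nat.one_div_le_one_div
  refine mem_closedConvexHull_survivalGraph_of_limit hG
    (Ordinal.isSuccLimit_mul_right hζ Ordinal.isSuccLimit_omega0)
    (f := fun m : ℕ => ζ * m) (δ := fun m => 1 / ((m : ℝ) + 1))
    (fun m k hmk => by dsimp only; gcongr) hanti ?_ fun m => ?_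
  · intro η hη κ hκ
    obtain ⟨ρ, hρ, hηρ⟩ := (Ordinal.lt_mul_iff_of_isSuccLimit Ordinal.isSuccLimit_omega0).1 hη
    obtain ⟨m, rfl⟩ := Ordinal.lt_omega0.1 hρ
    obtain ⟨k, hk⟩ := exists_nat_one_div_lt hκ
    refine ⟨max m k, hηρ.le.trans ?_, (hanti (le_max_right m k)).trans_lt hk⟩
    gcongr
    exact le_max_left m k
  · obtain ⟨n, hn, hmn⟩ : ∃ n : ℕ, 0 < n ∧ m * R < n * (1 / ((m : ℝ) + 1)) := by
      obtain ⟨n, hn⟩ := exists_nat_gt (max 0 (m * R / (1 / ((m : ℝ) + 1))))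
      rw [max_lt_iff] at hn
      exact ⟨n, Nat.cast_pos.1 hn.1, (div_lt_iff₀ (by positivity)).1 hn.2⟩
    have hqn : q ∈ oscSeq p ζ (fun _ : Fin n => ε) (closedConvexHull ℝ G) := by
      rw [oscSeq_const]
      refine oscIter_antitone p ε _ ?_ hq
      gcongr
      exact (Ordinal.natCast_lt_omega0 n).le
    let average : E × (Fin n → ℝ) →L[ℝ] E × ℝ := (ContinuousLinearMap.fst ℝ E _).prod
      ((n : ℝ)⁻¹ • ∑ i, ContinuousLinearMap.proj i ∘L ContinuousLinearMap.snd ℝ E _)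
    have haverage (x : E × (Fin n → ℝ)) : average x = (x.1, (n : ℝ)⁻¹ * ∑ i, x.2 i) := by
      simp [average]
    have hmem := mapsTo_closedConvexHull average (B := survivalGraph p (ζ * m) (1 / (m + 1)) R G)
      (fun x hx => (haverage x).symm ▸ average_mem_survivalGraph hn hmn hx)
      (h.seq hp hG hC hR (fun _ => hε) hqn)
    rwa [haverage, Finset.sum_const, Finset.card_univ, Fintype.card_fin, nsmul_eq_mul,
      inv_mul_cancel_left₀ (Nat.cast_ne_zero.2 hn.ne')] at hmem

theorem transfersDeriv_omega0_opow (ξ : Ordinal.{w}) :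
    TransfersDeriv.{v} (Ordinal.omega0 ^ ξ) := by
  induction ξ using Ordinal.limitRecOn with
  | zero =>
    rw [Ordinal.opow_zero]
    exact transfersDeriv_one
  | add_one ξ ih =>
    rw [Ordinal.opow_add_one]
    exact ih.mul_omega0 (Ordinal.opow_pos ξ Ordinal.omega0_pos)
  | limit ξ hξ ih =>
    intro E _ _ _ _ _ _ _ p G R ε hp hG hC hR hε q hq
    have : Nonempty (Set.Iio ξ) := ⟨⟨0, hξ.bot_lt⟩⟩
    refine mem_closedConvexHull_survivalGraph_of_limit hG
      (Ordinal.isSuccLimit_opow Ordinal.one_lt_omega0 hξ)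
      (f := fun ρ : Set.Iio ξ => Ordinal.omega0 ^ ρ.1) (δ := fun _ => 0)
      (fun ρ σ hρσ => Ordinal.opow_le_opow_right Ordinal.omega0_pos hρσ) antitone_const ?_
      fun ρ => ?_
    · intro η hη κ hκ
      obtain ⟨ρ, hρ, hηρ⟩ := (Ordinal.lt_opow_of_isSuccLimit Ordinal.omega0_ne_zero hξ).1 hη
      exact ⟨⟨ρ, hρ⟩, hηρ.le, hκ⟩
    · exact ih ρ.1 ρ.2 E p G R ε hp hG hC hR hε q (oscIter_antitone p ε _
        (Ordinal.opow_le_opow_right Ordinal.omega0_pos (Set.mem_Iio.1 ρ.2).le) hq)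

end Transfer

theorem TransfersDeriv.apply_half_le {E : Type v} [AddCommGroup E] [Module ℝ E]
    [TopologicalSpace E] [IsTopologicalAddGroup E] [ContinuousSMul ℝ E] [LocallyConvexSpace ℝ E]
    [T2Space E] {p : Seminorm ℝ E} {ζ : Ordinal.{w}} {G : Set E} {R : ℝ}
    (h : TransfersDeriv.{v} ζ) (hp : LowerSemicontinuous p) (hG : IsCompact G)
    (hC : IsCompact (closedConvexHull ℝ G)) (hR : ∀ y ∈ G, ∀ z ∈ G, p (y - z) ≤ R) {n : ℕ}
    {φ : (Fin n → ℝ) → ℝ} (hφ : ConvexOn ℝ Set.univ φ) (hφc : Continuous φ) {M : ℝ}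
    (hM : ∀ c, (oscSeq p ζ c G).Nonempty → φ c ≤ M) {a : Fin n → ℝ} (ha : ∀ i, 0 ≤ a i)
    (hne : (oscSeq p ζ a (closedConvexHull ℝ G)).Nonempty) : φ (fun i => a i / 2) ≤ M := by
  obtain ⟨q, hq⟩ := hne
  have hgraph : survivalSeqGraph p ζ R G n ⊆ {x | φ x.2 ≤ M} := by
    intro x hx
    have hlim : Tendsto (fun κ : ℝ => φ fun i => x.2 i - κ) (𝓝[>] 0) (𝓝 (φ fun i => x.2 i - 0)) :=
      ((hφc.comp (by fun_prop : Continuous fun κ : ℝ => fun i => x.2 i - κ)).tendsto 0).mono_left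
        nhdsWithin_le_nhds
    simp only [sub_zero] at hlim
    refine le_of_tendsto hlim ?_
    filter_upwards [self_mem_nhdsWithin] with κ hκ
    exact hM _ ⟨x.1, hx.2.2 _ fun i => sub_lt_self _ hκ⟩
  have hconv : Convex ℝ {x : E × (Fin n → ℝ) | φ x.2 ≤ M} := by
    have hlevel : Convex ℝ {c | φ c ≤ M} := by
      simpa only [Set.mem_univ, true_and] using hφ.convex_le M
    exact hlevel.linear_preimage (LinearMap.snd ℝ E (Fin n → ℝ))
  exact closedConvexHull_min hgraph hconv
    (isClosed_le (hφc.comp continuous_snd) continuous_const) (h.seq hp hG hC hR ha hq)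

section BalancedHull

variable {𝕜 E : Type*} [NormedField 𝕜] [AddCommGroup E] [Module 𝕜 E] {p : Seminorm 𝕜 E} {L : Set E}
  {R : ℝ}

theorem balancedHull_eq_image (L : Set E) : balancedHull 𝕜 L =
    (fun τ : 𝕜 × E => τ.1 • τ.2) '' (Metric.closedBall 0 1 ×ˢ L) := by
  ext x
  simp only [mem_balancedHull_iff, Set.mem_smul_set, Set.mem_image, Set.mem_prod,
    mem_closedBall_zero_iff, Prod.exists, and_assoc, exists_and_left]

theorem nonempty_of_nonempty_balancedHull (h : (balancedHull 𝕜 L).Nonempty) : L.Nonempty := by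
  obtain ⟨x, hx⟩ := h
  obtain ⟨c, -, y, hy, -⟩ := mem_balancedHull_iff.1 hx
  exact ⟨y, hy⟩

theorem seminorm_le_of_mem_balancedHull (hR : ∀ x ∈ L, p x ≤ R) :
    ∀ x ∈ balancedHull 𝕜 L, p x ≤ R := by
  intro x hx
  obtain ⟨c, hc, y, hy, rfl⟩ := mem_balancedHull_iff.1 hx
  dsimp only
  rw [map_smul_eq_mul]
  exact (mul_le_of_le_one_left (apply_nonneg p y) hc).trans (hR y hy)

variable [ProperSpace 𝕜] [TopologicalSpace E] [ContinuousSMul 𝕜 E]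

theorem isCompact_balancedHull (hL : IsCompact L) : IsCompact (balancedHull 𝕜 L) := by
  rw [balancedHull_eq_image]
  exact ((isCompact_closedBall 0 1).prod hL).image continuous_smul

variable [T2Space E]

theorem oscDeriv_balancedHull_subset (hL : IsCompact L) (hR : ∀ x ∈ L, p x ≤ R) (ε : ℝ) :
    oscDeriv p ε (balancedHull 𝕜 L) ⊆ balancedHull 𝕜 (oscDeriv p (ε / 4) L) := by
  rcases le_or_gt ε 0 with hε | hε
  · rw [oscDeriv_of_nonpos p hε, oscDeriv_of_nonpos p (by linarith)]
  intro x hx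
  by_contra hx'
  have hfreq := frequently_lt_of_mem_oscDeriv hε hx
  rw [balancedHull_eq_image] at hfreq hx'
  refine hfreq (eventually_nhdsWithin_image (P := fun y => ¬ε / 2 < p (y - x))
    ((isCompact_closedBall 0 1).prod hL) continuous_smul ?_)
  rintro ⟨c, t⟩ ⟨hc, ht⟩ rfl
  have ht' : t ∉ oscDeriv p (ε / 4) L := fun h => hx' ⟨(c, t), ⟨hc, h⟩, rfl⟩
  obtain ⟨V, hV, hdiam⟩ := exists_mem_nhdsWithin_of_notMem_oscDeriv ht ht'
  have hscalar : ∀ᶠ c' in 𝓝 c, ‖c' - c‖ * R < ε / 4 := by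
    have hlim : Tendsto (fun c' => ‖c' - c‖ * R) (𝓝 c) (𝓝 (‖c - c‖ * R)) :=
      Continuous.tendsto (by fun_prop) c
    rw [sub_self, norm_zero, zero_mul] at hlim
    exact hlim.eventually_lt_const (by linarith)
  rw [nhdsWithin_prod_eq]
  filter_upwards [(hscalar.filter_mono nhdsWithin_le_nhds).prod_inl _,
    (eventually_mem_nhdsWithin (a := c)).prod_inl _, Eventually.prod_inr hV _] with τ hlt hτ hτV
  rw [not_lt]
  calc p (τ.1 • τ.2 - c • t) = p (τ.1 • (τ.2 - t) + (τ.1 - c) • t) := by congr 1; module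
    _ ≤ ‖τ.1‖ * p (τ.2 - t) + ‖τ.1 - c‖ * p t := by
      simpa only [map_smul_eq_mul] using map_add_le_add p (τ.1 • (τ.2 - t)) ((τ.1 - c) • t)
    _ ≤ 1 * (ε / 4) + ‖τ.1 - c‖ * R := by
      gcongr
      · exact mem_closedBall_zero_iff.1 hτ
      · exact hdiam _ hτV _ (mem_of_mem_nhdsWithin ht hV)
      · exact hR t ht
    _ ≤ ε / 2 := by linarith

theorem oscIter_balancedHull_subset (hL : IsCompact L) (hR : ∀ x ∈ L, p x ≤ R) (ε : ℝ)
    (ζ : Ordinal.{w}) :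
    oscIter p ε ζ (balancedHull 𝕜 L) ⊆ balancedHull 𝕜 (oscIter p (ε / 4) ζ L) := by
  have hcompact (η : Ordinal.{w}) : IsCompact (oscIter p (ε / 4) η L) :=
    hL.of_isClosed_subset (isClosed_oscIter hL.isClosed η) (oscIter_subset p _ η L)
  unfold oscIter at hcompact ⊢
  induction ζ using Ordinal.limitRecOn with
  | zero => simp only [transfiniteIter_zero, subset_rfl]
  | add_one ζ ih =>
    simp only [transfiniteIter_add_one]
    exact (oscDeriv_mono ih).trans
      (oscDeriv_balancedHull_subset (hcompact ζ) (fun x hx => hR x (oscIter_subset p _ ζ L hx)) ε)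
  | limit ζ hζ ih =>
    have : Nonempty (Set.Iio ζ) := ⟨⟨0, hζ.bot_lt⟩⟩
    simp only [transfiniteIter_limit _ hζ]
    refine (Set.iInter_mono fun η : Set.Iio ζ => ih η.1 η.2).trans ?_
    simp only [balancedHull_eq_image]
    refine (iInter_image_subset_image_iInter
      (D := fun η : Set.Iio ζ => Metric.closedBall (0 : 𝕜) 1 ×ˢ oscIter p (ε / 4) η.1 L)
      (fun η ρ hηρ => Set.prod_mono_right (oscIter_antitone p (ε / 4) L hηρ))
      (fun η => (isCompact_closedBall 0 1).prod (hcompact η.1)) continuous_smul).trans ?_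
    refine Set.image_mono fun τ hτ => ?_
    rw [Set.mem_iInter] at hτ
    exact ⟨(hτ (Classical.arbitrary _)).1, Set.mem_iInter.2 fun η => (hτ η).2⟩

theorem oscSeq_balancedHull_subset (hL : IsCompact L) (hR : ∀ x ∈ L, p x ≤ R) (ζ : Ordinal.{w})
    {n : ℕ} (a : Fin n → ℝ) :
    oscSeq p ζ a (balancedHull 𝕜 L) ⊆ balancedHull 𝕜 (oscSeq p ζ (fun i => a i / 4) L) := by
  induction n with
  | zero => exact subset_rfl
  | succ n ih =>
    have hcompact := hL.of_isClosed_subset (isClosed_oscSeq hL.isClosed ζ fun i => a i.succ / 4)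
      (oscSeq_subset p ζ _ L)
    exact (oscIter_mono (ih _) le_rfl ζ).trans (oscIter_balancedHull_subset hcompact
      (fun x hx => hR x (oscSeq_subset p ζ _ L hx)) (a 0) ζ)

end BalancedHull

theorem apply_div_eight_le {𝕜 : Type*} {E : Type v} [RCLike 𝕜] [AddCommGroup E] [Module 𝕜 E]
    [Module ℝ E] [IsScalarTower ℝ 𝕜 E] [TopologicalSpace E] [IsTopologicalAddGroup E]
    [ContinuousSMul 𝕜 E] [ContinuousSMul ℝ E] [LocallyConvexSpace ℝ E] [T2Space E]
    {p : Seminorm 𝕜 E} {ξ : Ordinal.{w}} {L : Set E} (hp : LowerSemicontinuous p)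
    (hL : IsCompact L) (hC : IsCompact (closedConvexHull ℝ (balancedHull 𝕜 L))) {R : ℝ}
    (hR : ∀ x ∈ L, p x ≤ R) {n : ℕ} {φ : (Fin n → ℝ) → ℝ} (hφ : ConvexOn ℝ Set.univ φ)
    (hφc : Continuous φ) {M : ℝ}
    (hM : ∀ c, (oscSeq p (Ordinal.omega0 ^ ξ) c L).Nonempty → φ c ≤ M) {a : Fin n → ℝ}
    (ha : ∀ i, 0 ≤ a i)
    (hne : (oscSeq p (Ordinal.omega0 ^ ξ) a (closedConvexHull ℝ (balancedHull 𝕜 L))).Nonempty) :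
    φ (fun i => a i / 8) ≤ M := by
  have hscale : ConvexOn ℝ Set.univ fun c : Fin n → ℝ => φ ((1 / 4 : ℝ) • c) :=
    hφ.comp_linearMap (LinearMap.lsmul ℝ (Fin n → ℝ) (1 / 4))
  convert (transfersDeriv_omega0_opow ξ).apply_half_le (p := p.restrictScalars ℝ) (R := R + R)
    (M := M) hp (isCompact_balancedHull hL) hC ?_ hscale (by fun_prop) ?_ ha hne using 2
  · ext i
    simp only [Pi.smul_apply, smul_eq_mul]
    ring
  · intro y hy z hz
    exact (map_sub_le_add p y z).trans (add_le_add (seminorm_le_of_mem_balancedHull hR y hy)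
      (seminorm_le_of_mem_balancedHull hR z hz))
  · intro c hc
    have hcL := nonempty_of_nonempty_balancedHull (hc.mono (oscSeq_balancedHull_subset hL hR _ c))
    convert hM _ hcL using 3 with i
    simp only [Pi.smul_apply, smul_eq_mul]
    ring

theorem convexOn_sum_max_zero_rpow {ι : Type*} [Fintype ι] {q : ℝ} (hq : 1 ≤ q) :
    ConvexOn ℝ Set.univ fun a : ι → ℝ => ∑ i, max (a i) 0 ^ q := by
  refine ⟨convex_univ, fun a _ b _ s t hs ht hst => ?_⟩
  simp only [Finset.smul_sum, ← Finset.sum_add_distrib]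
  gcongr with i
  have hmax : max (s * a i + t * b i) 0 ≤ s * max (a i) 0 + t * max (b i) 0 :=
    max_le (by gcongr <;> exact le_max_left _ _) (by positivity)
  exact (Real.rpow_le_rpow (le_max_right _ _) hmax (by linarith)).trans
    ((convexOn_rpow hq).2 (Set.mem_Ici.2 (le_max_right _ _)) (Set.mem_Ici.2 (le_max_right _ _))
      hs ht hst)

section WeakDual

variable {𝕜 : Type u} [RCLike 𝕜] {X : Type v} [NormedAddCommGroup X] [NormedSpace 𝕜 X]
  {K : Set (WeakDual 𝕜 X)} {ε : ℝ} {ζ ξ : Ordinal.{w}}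

instance : IsScalarTower ℝ 𝕜 (WeakDual 𝕜 X) :=
  ⟨fun r c x => DFunLike.ext _ _ fun y => smul_assoc r c (x y)⟩

instance : LocallyConvexSpace ℝ (WeakDual 𝕜 X) :=
  (WeakDual.withSeminorms 𝕜 X).toLocallyConvexSpace

variable (𝕜 X) in
/-- The dual norm, as a seminorm on the weak* dual. It measures the diameters in the derivations
`s_ε`. -/
def dualNorm : Seminorm 𝕜 (WeakDual 𝕜 X) :=
  (normSeminorm 𝕜 (StrongDual 𝕜 X)).comp WeakDual.toStrongDual.toLinearMap

theorem lowerSemicontinuous_dualNorm : LowerSemicontinuous (dualNorm 𝕜 X) := by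
  rw [lowerSemicontinuous_iff_isClosed_preimage]
  intro r
  convert WeakDual.isClosed_closedBall (0 : StrongDual 𝕜 X) r using 1
  ext x
  exact (mem_closedBall_zero_iff (a := WeakDual.toStrongDual x)).symm

theorem exists_dualNorm_le (hK : Bornology.IsBounded K) : ∃ R, ∀ x ∈ K, dualNorm 𝕜 X x ≤ R :=
  isBounded_iff_forall_norm_le.1 (WeakDual.isBounded_toWeakDual_preimage_iff_isBounded.2 hK)

theorem subset_weakStarAbsCo (K : Set (WeakDual 𝕜 X)) : K ⊆ weakStarAbsCo K :=
  subset_absConvexHull.trans subset_closure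

theorem convex_weakStarAbsCo (K : Set (WeakDual 𝕜 X)) : Convex ℝ (weakStarAbsCo K) :=
  (convex_RCLike_iff_convex_real.1 (convex_absConvexHull (𝕜 := 𝕜) (s := K))).closure

theorem weakStarAbsCo_eq_closedConvexHull (K : Set (WeakDual 𝕜 X)) :
    weakStarAbsCo K = closedConvexHull ℝ (balancedHull 𝕜 K) := by
  refine (closure_minimal ?_ isClosed_closedConvexHull).antisymm
    (closedConvexHull_min ?_ (convex_weakStarAbsCo K) isClosed_closure)
  · rw [absConvexHull_eq_convexHull_balancedHull]
    exact convexHull_min subset_closedConvexHull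
      (convex_RCLike_iff_convex_real.2 convex_closedConvexHull)
  · exact (balanced_absConvexHull.balancedHull_subset_of_subset subset_absConvexHull).trans
      subset_closure

theorem isCompact_weakStarAbsCo (hK : Bornology.IsBounded K) : IsCompact (weakStarAbsCo K) := by
  obtain ⟨R, hR⟩ := exists_dualNorm_le hK
  have hconv : Convex ℝ {x | dualNorm 𝕜 X x ≤ R} := by
    simpa only [Seminorm.closedBall_zero_eq] using (dualNorm 𝕜 X).convex_closedBall 0 R
  have hball : weakStarAbsCo K ⊆ {x | dualNorm 𝕜 X x ≤ R} := by
    rw [weakStarAbsCo_eq_closedConvexHull]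
    exact closedConvexHull_min (seminorm_le_of_mem_balancedHull hR) hconv
      (lowerSemicontinuous_dualNorm.isClosed_preimage R)
  refine WeakDual.isCompact_of_bounded_of_closed
    (WeakDual.isBounded_toWeakDual_preimage_iff_isBounded.1 ?_) isClosed_closure
  exact isBounded_iff_forall_norm_le.2 ⟨R, fun x hx => hball hx⟩

theorem apply_div_eight_le_of_nonempty_oscSeq (hK : IsCompact K) (hb : Bornology.IsBounded K)
    {n : ℕ} {φ : (Fin n → ℝ) → ℝ} (hφ : ConvexOn ℝ Set.univ φ) (hφc : Continuous φ) {M : ℝ}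
    (hM : ∀ c, (oscSeq (dualNorm 𝕜 X) (Ordinal.omega0 ^ ξ) c K).Nonempty → φ c ≤ M)
    {a : Fin n → ℝ} (ha : ∀ i, 0 ≤ a i)
    (hne : (oscSeq (dualNorm 𝕜 X) (Ordinal.omega0 ^ ξ) a (weakStarAbsCo K)).Nonempty) :
    φ (fun i => a i / 8) ≤ M := by
  obtain ⟨R, hR⟩ := exists_dualNorm_le hb
  have hhull := isCompact_weakStarAbsCo hb
  rw [weakStarAbsCo_eq_closedConvexHull] at hhull hne
  exact apply_div_eight_le lowerSemicontinuous_dualNorm hK hhull hR hφ hφc hM ha hne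

theorem derivList_ofFn {n : ℕ} (a : Fin n → ℝ) :
    derivList ζ (List.ofFn a) K = oscSeq (dualNorm 𝕜 X) ζ a K := by
  induction n with
  | zero => rfl
  | succ n ih =>
    rw [List.ofFn_succ, oscSeq, ← ih]
    rfl

theorem hasSummableWith_iff {M q : ℝ} : HasSummableWith M ξ q K ↔ ∀ (n : ℕ) (a : Fin n → ℝ),
    (oscSeq (dualNorm 𝕜 X) (Ordinal.omega0 ^ ξ) a K).Nonempty →
      ∑ i, max (a i) 0 ^ q ≤ M ^ q := by
  simp only [HasSummableWith, List.forall_iff_forall_tuple, derivList_ofFn,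
    List.forall_mem_ofFn_iff, List.map_ofFn, List.sum_ofFn, Function.comp_apply]
  refine forall_congr' fun n => ⟨fun h a hne => ?_, fun h a ha hne => ?_⟩
  · exact h _ (fun i => le_max_right (a i) 0) (by rwa [oscSeq_max_zero])
  · simpa only [max_eq_left (ha _)] using h a hne

theorem HasSummableWith.weakStarAbsCo (hK : IsCompact K) (hb : Bornology.IsBounded K) {M q : ℝ}
    (hM : 0 ≤ M) (hq : 1 ≤ q) (h : HasSummableWith M ξ q K) :
    HasSummableWith (8 * M) ξ q (weakStarAbsCo K) := by
  rw [hasSummableWith_iff] at h ⊢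
  intro n a hne
  rw [← oscSeq_max_zero] at hne
  have hsum := apply_div_eight_le_of_nonempty_oscSeq hK hb (convexOn_sum_max_zero_rpow hq)
    (by fun_prop (disch := linarith)) (h n) (fun i => le_max_right (a i) 0) hne
  have hterm (i : Fin n) : max (max (a i) 0 / 8) 0 ^ q = max (a i) 0 ^ q / 8 ^ q := by
    rw [max_eq_left (by positivity), Real.div_rpow (le_max_right _ _) (by norm_num)]
  rw [Finset.sum_congr rfl fun i _ => hterm i, ← Finset.sum_div,
    div_le_iff₀ (by positivity)] at hsum
  rwa [Real.mul_rpow (by norm_num) hM, mul_comm]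

theorem HasSummableWith.mono {L : Set (WeakDual 𝕜 X)} {M q : ℝ} (h : HasSummableWith M ξ q L)
    (hKL : K ⊆ L) : HasSummableWith M ξ q K :=
  hasSummableWith_iff.2 fun n a hne =>
    hasSummableWith_iff.1 h n a (hne.mono (oscSeq_mono hKL _ a))

theorem hasSummable_weakStarAbsCo_iff (hK : IsCompact K) (hb : Bornology.IsBounded K) {q : ℝ}
    (hq : 1 ≤ q) : HasSummable ξ q K ↔ HasSummable ξ q (weakStarAbsCo K) :=
  ⟨fun ⟨M, hM, h⟩ => ⟨8 * M, by positivity, h.weakStarAbsCo hK hb hM hq⟩,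
    fun ⟨M, hM, h⟩ => ⟨M, hM, h.mono (subset_weakStarAbsCo K)⟩⟩

end WeakDual

section Convex

variable {𝕜 E : Type*} [RCLike 𝕜] [AddCommGroup E] [Module 𝕜 E] [Module ℝ E]
  [IsScalarTower ℝ 𝕜 E] [TopologicalSpace E] [IsTopologicalAddGroup E] [ContinuousConstSMul ℝ E]
  {p : Seminorm 𝕜 E} {ε : ℝ} {ζ : Ordinal.{w}} {A C : Set E} {x : E}

theorem mapsTo_smul_add_oscIter {r : ℝ} (hr : 0 < r) {v : E} {B : Set E}
    (hAB : Set.MapsTo (fun z => r • z + v) A B) :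
    Set.MapsTo (fun z => r • z + v) (oscIter p ε ζ A) (oscIter p (r * ε) ζ B) := by
  refine mapsTo_oscIter (by fun_prop) (fun h => (mul_pos_iff_of_pos_left hr).1 h)
    (fun y z hyz => ?_) hAB ζ
  have hscale : p (r • (y - z)) = ‖r‖ * p (y - z) :=
    map_smul_eq_mul (p.restrictScalars ℝ) r (y - z)
  rw [add_sub_add_right_eq_sub, ← smul_sub, hscale, Real.norm_of_nonneg hr.le]
  gcongr

theorem add_smul_mem_oscIter_mul_nat (hAC : A ⊆ C) (hC : Convex ℝ C) (hx : x ∈ oscIter p ε ζ A)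
    {n k : ℕ} (hk : k ≤ n) (hn : n ≠ 0) {y : E} (hy : y ∈ C) :
    (k / n : ℝ) • x + (1 - k / n : ℝ) • y ∈ oscIter p ((n : ℝ)⁻¹ * ε) (ζ * k) C := by
  have hn' : (0 : ℝ) < n := by positivity
  induction k generalizing y with
  | zero =>
    simpa only [Nat.cast_zero, zero_div, zero_smul, sub_zero, one_smul, zero_add, mul_zero, oscIter,
      transfiniteIter_zero] using hy
  | succ k ih =>
    have hkn : (0 : ℝ) < n - k := sub_pos.2 (by exact_mod_cast hk)
    have hk' : (0 : ℝ) ≤ n - k - 1 := by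
      rw [sub_sub, sub_nonneg]
      exact_mod_cast hk
    set v := (k / n : ℝ) • x + (1 - (k + 1) / n : ℝ) • y
    have hmaps : Set.MapsTo (fun z => (n : ℝ)⁻¹ • z + v) A
        (oscIter p ((n : ℝ)⁻¹ * ε) (ζ * k) C) := by
      intro z hz
      have hmix : (1 / (n - k) : ℝ) • z + ((n - k - 1) / (n - k) : ℝ) • y ∈ C :=
        hC (hAC hz) hy (by positivity) (by positivity) (by field_simp; ring)
      convert ih (by lia) hmix using 1
      match_scalars <;> field_simp
      ring
    have hstep := mapsTo_smul_add_oscIter (p := p) (inv_pos.2 hn') hmaps hx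
    rw [← oscIter_add, ← mul_add_one, ← Nat.cast_add_one] at hstep
    convert hstep using 1
    simp only [v]
    push_cast
    match_scalars <;> field_simp
    ring

theorem mem_oscIter_mul_nat (hAC : A ⊆ C) (hC : Convex ℝ C) (hx : x ∈ oscIter p ε ζ A) {n : ℕ}
    (hn : n ≠ 0) : x ∈ oscIter p ((n : ℝ)⁻¹ * ε) (ζ * n) C := by
  have hmem := add_smul_mem_oscIter_mul_nat hAC hC hx le_rfl hn (hAC (oscIter_subset p ε ζ A hx))
  rwa [div_self (by exact_mod_cast hn), sub_self, one_smul, zero_smul, add_zero] at hmem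

end Convex

section Asymptotics

variable {f : ℝ → ℕ} {C q : ℝ}

theorem log_mul_rpow_neg (hC : 0 < C) {ε : ℝ} (hε : ε ∈ Set.Ioo 0 1) :
    Real.log (C * ε ^ (-q)) = q * |Real.log ε| + Real.log C := by
  rw [Real.log_mul hC.ne' (Real.rpow_pos_of_pos hε.1 _).ne', Real.log_rpow hε.1,
    abs_of_neg (Real.log_neg hε.1 hε.2)]
  ring

theorem abs_log_pos {ε : ℝ} (hε : ε ∈ Set.Ioo 0 1) : 0 < |Real.log ε| :=
  abs_pos.2 (Real.log_neg hε.1 hε.2).ne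

theorem limsup_add_div_abs_log (q b : ℝ) :
    limsup (fun ε : ℝ => ((q + b / |Real.log ε| : ℝ) : EReal)) (𝓝[>] 0) = q := by
  have hlog : Tendsto (fun ε : ℝ => |Real.log ε|) (𝓝[>] 0) atTop :=
    tendsto_abs_atBot_atTop.comp Real.tendsto_log_nhdsGT_zero
  refine Tendsto.limsup_eq ((continuous_coe_real_ereal.tendsto q).comp ?_)
  simpa only [add_zero] using (hlog.const_div_atTop b).const_add q

theorem limsup_log_div_abs_log_le (hC : 1 ≤ C) (hq : 0 ≤ q)
    (h : ∀ᶠ ε in 𝓝[>] 0, f ε ≤ C * ε ^ (-q)) :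
    limsup (fun ε : ℝ => ((Real.log (f ε) / |Real.log ε| : ℝ) : EReal)) (𝓝[>] 0) ≤ q := by
  rw [← limsup_add_div_abs_log q (Real.log C)]
  refine limsup_le_limsup ?_
  filter_upwards [h, Ioo_mem_nhdsGT (zero_lt_one (α := ℝ))] with ε hfε hε
  have hlog := abs_log_pos hε
  rw [EReal.coe_le_coe_iff, div_le_iff₀ hlog, add_mul, div_mul_cancel₀ _ hlog.ne']
  rcases Nat.eq_zero_or_pos (f ε) with hzero | hpos
  · rw [hzero, Nat.cast_zero, Real.log_zero]
    exact add_nonneg (by positivity) (Real.log_nonneg hC)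
  · rw [← log_mul_rpow_neg (by linarith) hε]
    exact Real.log_le_log (by exact_mod_cast hpos) hfε

theorem le_limsup_log_div_abs_log (hC : 0 < C) (h : ∀ᶠ ε in 𝓝[>] 0, C * ε ^ (-q) ≤ f ε) :
    q ≤ limsup (fun ε : ℝ => ((Real.log (f ε) / |Real.log ε| : ℝ) : EReal)) (𝓝[>] 0) := by
  rw [← limsup_add_div_abs_log q (Real.log C)]
  refine limsup_le_limsup ?_
  filter_upwards [h, Ioo_mem_nhdsGT (zero_lt_one (α := ℝ))] with ε hfε hε
  have hlog := abs_log_pos hε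
  rw [EReal.coe_le_coe_iff, le_div_iff₀ hlog, add_mul, div_mul_cancel₀ _ hlog.ne',
    ← log_mul_rpow_neg hC hε]
  exact Real.log_le_log (mul_pos hC (Real.rpow_pos_of_pos hε.1 _)) hfε

theorem eventually_lt_rpow_neg_of_limsup_log_lt
    (h : limsup (fun ε : ℝ => ((Real.log (f ε) / |Real.log ε| : ℝ) : EReal)) (𝓝[>] 0) < q) :
    ∀ᶠ ε in 𝓝[>] 0, f ε < ε ^ (-q) := by
  filter_upwards [eventually_lt_of_limsup_lt h, Ioo_mem_nhdsGT (zero_lt_one (α := ℝ))] with ε hfε hε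
  have hpow : 0 < ε ^ (-q) := Real.rpow_pos_of_pos hε.1 _
  rcases Nat.eq_zero_or_pos (f ε) with hzero | hpos
  · rwa [hzero, Nat.cast_zero]
  · refine (Real.log_lt_log_iff (by exact_mod_cast hpos) hpow).1 ?_
    rw [EReal.coe_lt_coe_iff, div_lt_iff₀ (abs_log_pos hε)] at hfε
    simpa only [one_mul, Real.log_one, add_zero] using
      hfε.trans_eq (by rw [log_mul_rpow_neg zero_lt_one hε, Real.log_one, add_zero] :
        q * |Real.log ε| = Real.log (1 * ε ^ (-q)))

end Asymptotics

theorem sum_rpow_le_of_card_le {ι : Type*} {a : ι → ℝ} {B q r : ℝ} (hB : 0 ≤ B) (hr : 0 < r)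
    (hq : 0 < q) (S : Finset ι) (ha : ∀ i ∈ S, 0 ≤ a i)
    (hcard : ∀ c > 0, ((S.filter fun i => c ≤ a i).card : ℝ) ≤ (B / c) ^ r) :
    ∑ i ∈ S, a i ^ q ≤ B ^ q * ∑ j ∈ Finset.range S.card, 1 / ((j + 1 : ℕ) : ℝ) ^ (q / r) := by
  classical
  induction hn : S.card generalizing S with
  | zero => simp only [Finset.card_eq_zero.1 hn, Finset.sum_empty, Finset.range_zero, mul_zero,
      le_refl]
  | succ n ih =>
    have hS : S.Nonempty := Finset.card_pos.1 (by lia)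
    obtain ⟨i, hi, hmin⟩ := S.exists_min_image a hS
    have hrest := ih (S.erase i) (fun j hj => ha j (Finset.mem_of_mem_erase hj))
      (fun c hc => le_trans (by gcongr; exact Finset.erase_subset i S) (hcard c hc))
      (by rw [Finset.card_erase_of_mem hi, hn, Nat.add_sub_cancel])
    have hleast : a i ^ q ≤ B ^ q * (1 / ((n + 1 : ℕ) : ℝ) ^ (q / r)) := by
      rcases (ha i hi).eq_or_lt with hzero | hpos
      · rw [← hzero, Real.zero_rpow hq.ne']
        positivity
      have hcount := hcard (a i) hpos
      rw [Finset.filter_true_of_mem hmin, hn] at hcount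
      have hpow : ((n + 1 : ℕ) : ℝ) ^ (q / r) ≤ B ^ q / a i ^ q := by
        calc ((n + 1 : ℕ) : ℝ) ^ (q / r) ≤ ((B / a i) ^ r) ^ (q / r) := by gcongr
          _ = (B / a i) ^ q := by rw [← Real.rpow_mul (by positivity), mul_div_cancel₀ _ hr.ne']
          _ = B ^ q / a i ^ q := Real.div_rpow hB hpos.le q
      rwa [mul_one_div, le_div_comm₀ (Real.rpow_pos_of_pos hpos q) (by positivity)]
    rw [← Finset.add_sum_erase _ _ hi, Finset.sum_range_succ, mul_add, add_comm]
    exact add_le_add hrest hleast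

theorem exists_sum_rpow_le_of_card_le {B q r : ℝ} (hB : 0 ≤ B) (hr : 0 < r) (hrq : r < q) :
    ∃ S : ℝ, 0 ≤ S ∧ ∀ (n : ℕ) (a : Fin n → ℝ), (∀ i, 0 ≤ a i) →
      (∀ c > 0, ((Finset.univ.filter fun i => c ≤ a i).card : ℝ) ≤ (B / c) ^ r) →
        ∑ i, a i ^ q ≤ S := by
  have hsummable : Summable fun j : ℕ => 1 / ((j + 1 : ℕ) : ℝ) ^ (q / r) :=
    (summable_nat_add_iff 1).2 (Real.summable_one_div_nat_rpow.2 ((one_lt_div hr).2 hrq))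
  refine ⟨B ^ q * ∑' j : ℕ, 1 / ((j + 1 : ℕ) : ℝ) ^ (q / r), ?_, fun n a ha hcard => ?_⟩
  · exact mul_nonneg (by positivity) (tsum_nonneg fun j => by positivity)
  · refine (sum_rpow_le_of_card_le hB hr (hr.trans hrq) Finset.univ (fun i _ => ha i)
      hcard).trans ?_
    gcongr
    exact hsummable.sum_le_tsum _ fun j _ => by positivity

section PowerType

variable {𝕜 : Type u} [RCLike 𝕜] {X : Type v} [NormedAddCommGroup X] [NormedSpace 𝕜 X]
  {K L : Set (WeakDual 𝕜 X)} {ε : ℝ} {ζ ξ : Ordinal.{w}}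

theorem derivIter_antitone (ε : ℝ) (K : Set (WeakDual 𝕜 X)) :
    Antitone fun ζ : Ordinal.{w} => derivIter ε ζ K :=
  oscIter_antitone (dualNorm 𝕜 X) ε K

theorem derivIter_mono {ε' : ℝ} (hKL : K ⊆ L) (hε : ε' ≤ ε) (ζ : Ordinal.{w}) :
    derivIter ε ζ K ⊆ derivIter ε' ζ L :=
  oscIter_mono (p := dualNorm 𝕜 X) hKL hε ζ

theorem szlenkAt_le_iff : szlenkAt K ε ≤ ζ ↔ derivIter ε ζ K = ∅ := by
  refine ⟨fun h => ?_, fun h => sInf_le ⟨ζ, h, rfl⟩⟩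
  have hne : ((fun ζ : Ordinal.{w} => (ζ : WithTop Ordinal.{w})) ''
      {ζ | derivIter ε ζ K = ∅}).Nonempty := by
    by_contra hempty
    rw [szlenkAt, Set.not_nonempty_iff_eq_empty.1 hempty, sInf_empty, top_le_iff] at h
    exact WithTop.coe_ne_top h
  obtain ⟨η, hη, hmin⟩ := csInf_mem hne
  rw [szlenkAt, ← hmin, WithTop.coe_le_coe] at h
  exact Set.subset_eq_empty (derivIter_antitone ε K h) hη

theorem szlenk_le_iff : szlenk K ≤ ζ ↔ ∀ ε > 0, derivIter ε ζ K = ∅ := by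
  simp only [szlenk, iSup_le_iff, szlenkAt_le_iff, Subtype.forall, gt_iff_lt]

theorem exists_nat_derivIter_eq_empty (hK : IsCompact K)
    (h : derivIter ε (Ordinal.omega0 ^ (ξ + 1)) K = ∅) :
    ∃ n : ℕ, derivIter ε (Ordinal.omega0 ^ ξ * n) K = ∅ := by
  by_contra! hne
  have hclosed (n : ℕ) : IsClosed (derivIter ε (Ordinal.omega0 ^ ξ * n) K) :=
    isClosed_oscIter (p := dualNorm 𝕜 X) hK.isClosed _
  obtain ⟨x, hx⟩ := IsCompact.nonempty_iInter_of_directed_nonempty_isCompact_isClosed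
    (fun n : ℕ => derivIter ε (Ordinal.omega0 ^ ξ * n) K)
    (directed_of_isDirected_le fun m n hmn => derivIter_antitone ε K (by gcongr)) hne
    (fun n => hK.of_isClosed_subset (hclosed n) (oscIter_subset (dualNorm 𝕜 X) _ _ K)) hclosed
  refine Set.eq_empty_iff_forall_notMem.1 h x ?_
  rw [Ordinal.opow_add_one]
  refine iInter_transfiniteIter_subset (oscDeriv_subset (dualNorm 𝕜 X) ε)
    (Ordinal.isSuccLimit_mul_right (Ordinal.opow_pos ξ Ordinal.omega0_pos)
      Ordinal.isSuccLimit_omega0) (fun ζ hζ => ?_) K hx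
  obtain ⟨η, hη, hζη⟩ := (Ordinal.lt_mul_iff_of_isSuccLimit Ordinal.isSuccLimit_omega0).1 hζ
  obtain ⟨m, rfl⟩ := Ordinal.lt_omega0.1 hη
  exact ⟨m, hζη.le⟩

theorem szlenkNat_le {n : ℕ} (h : derivIter ε (Ordinal.omega0 ^ ξ * n) K = ∅) :
    szlenkNat ξ K ε ≤ n :=
  Nat.sInf_le (szlenkAt_le_iff.2 h)

theorem derivIter_szlenkNat (hK : IsCompact K)
    (h : derivIter ε (Ordinal.omega0 ^ (ξ + 1)) K = ∅) :
    derivIter ε (Ordinal.omega0 ^ ξ * szlenkNat ξ K ε) K = ∅ := by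
  obtain ⟨n, hn⟩ := exists_nat_derivIter_eq_empty hK h
  exact szlenkAt_le_iff.1 (Nat.sInf_mem (s := {n : ℕ | szlenkAt K ε ≤
    ((Ordinal.omega0 ^ ξ * (n : Ordinal.{w}) : Ordinal.{w}) : WithTop Ordinal.{w})})
    ⟨n, szlenkAt_le_iff.2 hn⟩)

theorem lt_szlenkNat (hK : IsCompact K) (h : derivIter ε (Ordinal.omega0 ^ (ξ + 1)) K = ∅)
    {n : ℕ} (hn : (derivIter ε (Ordinal.omega0 ^ ξ * n) K).Nonempty) : n < szlenkNat ξ K ε := by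
  by_contra! hle
  refine hn.ne_empty (Set.subset_eq_empty ?_ (derivIter_szlenkNat hK h))
  exact derivIter_antitone ε K (by gcongr)

theorem powerType_eq_limsup (h : szlenk K ≤ (Ordinal.omega0 ^ (ξ + 1) : Ordinal.{w})) :
    powerType ξ K =
      limsup (fun ε : ℝ => ((Real.log (szlenkNat ξ K ε) / |Real.log ε| : ℝ) : EReal)) (𝓝[>] 0) :=
  if_pos h

theorem szlenk_le_of_powerType_lt {r : EReal} (h : powerType ξ K < r) :
    szlenk K ≤ (Ordinal.omega0 ^ (ξ + 1) : Ordinal.{w}) := by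
  by_contra hsz
  rw [powerType, if_neg hsz] at h
  exact not_top_lt h

theorem powerType_mono (hKL : K ⊆ L) (hL : IsCompact L) (ξ : Ordinal.{w}) :
    powerType ξ K ≤ powerType ξ L := by
  refine le_of_forall_gt fun r hr => lt_of_le_of_lt ?_ hr
  have hszL := szlenk_le_iff.1 (szlenk_le_of_powerType_lt hr)
  have hszK : szlenk K ≤ (Ordinal.omega0 ^ (ξ + 1) : Ordinal.{w}) :=
    szlenk_le_iff.2 fun ε hε => Set.subset_eq_empty (derivIter_mono hKL le_rfl _) (hszL ε hε)
  rw [powerType_eq_limsup hszK, powerType_eq_limsup (szlenk_le_of_powerType_lt hr)]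
  refine limsup_le_limsup ?_
  filter_upwards [self_mem_nhdsWithin] with ε hε
  have hle : szlenkNat ξ K ε ≤ szlenkNat ξ L ε :=
    szlenkNat_le (Set.subset_eq_empty (derivIter_mono hKL le_rfl _)
      (derivIter_szlenkNat hL (hszL ε hε)))
  have hlog : Real.log (szlenkNat ξ K ε) ≤ Real.log (szlenkNat ξ L ε) := by
    rcases Nat.eq_zero_or_pos (szlenkNat ξ K ε) with hzero | hpos
    · rw [hzero, Nat.cast_zero, Real.log_zero]
      exact Real.log_natCast_nonneg _
    · exact Real.log_le_log (by exact_mod_cast hpos) (by exact_mod_cast hle)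
  rw [EReal.coe_le_coe_iff]
  gcongr

theorem powerType_eq_zero (h : szlenk K ≤ (Ordinal.omega0 ^ ξ : Ordinal.{w})) :
    powerType ξ K = 0 := by
  have hsucc : Ordinal.omega0 ^ ξ ≤ Ordinal.omega0 ^ (ξ + 1) :=
    Ordinal.opow_le_opow_right Ordinal.omega0_pos (le_add_of_nonneg_right zero_le)
  rw [powerType_eq_limsup (h.trans (WithTop.coe_le_coe.2 hsucc))]
  refine Tendsto.limsup_eq (tendsto_const_nhds.congr' ?_)
  filter_upwards [self_mem_nhdsWithin] with ε hε
  have hle : szlenkNat ξ K ε ≤ 1 :=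
    szlenkNat_le (by rw [Nat.cast_one, mul_one]; exact szlenk_le_iff.1 h ε hε)
  have hlog : Real.log (szlenkNat ξ K ε) = 0 := by
    rcases Nat.le_one_iff_eq_zero_or_eq_one.1 hle with h0 | h1
    · rw [h0, Nat.cast_zero, Real.log_zero]
    · rw [h1, Nat.cast_one, Real.log_one]
  rw [hlog, zero_div, EReal.coe_zero]

/-- The weak-type counterpart of `HasSummableWith`: at most `(B / ε) ^ r` successive derivations
`s_ε^{ω^ξ}` leave `K` non-empty. -/
def HasWeaklySummableWith (B : ℝ) (ξ : Ordinal.{w}) (r : ℝ) (K : Set (WeakDual 𝕜 X)) : Prop :=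
  ∀ ε > 0, ∀ n : ℕ, (derivIter ε (Ordinal.omega0 ^ ξ * n) K).Nonempty → (n : ℝ) ≤ (B / ε) ^ r

theorem HasSummableWith.hasWeaklySummableWith {M q : ℝ} (hM : 0 ≤ M)
    (h : HasSummableWith M ξ q K) : HasWeaklySummableWith M ξ q K := by
  intro ε hε n hn
  have hsum := hasSummableWith_iff.1 h n (fun _ => ε) (by rwa [oscSeq_const])
  rw [Finset.sum_const, Finset.card_univ, Fintype.card_fin, nsmul_eq_mul, max_eq_left hε.le] at hsum
  rwa [Real.div_rpow hM hε.le, le_div_iff₀ (Real.rpow_pos_of_pos hε q)]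

theorem HasWeaklySummableWith.hasSummable {B q r : ℝ} (h : HasWeaklySummableWith B ξ r K)
    (hB : 0 ≤ B) (hr : 0 < r) (hrq : r < q) : HasSummable ξ q K := by
  obtain ⟨S, hS, hsum⟩ := exists_sum_rpow_le_of_card_le hB hr hrq
  refine ⟨S ^ q⁻¹, by positivity, hasSummableWith_iff.2 fun n a hne => ?_⟩
  rw [Real.rpow_inv_rpow hS (hr.trans hrq).ne']
  rw [← oscSeq_max_zero] at hne
  exact hsum n _ (fun i => le_max_right _ _) fun c hc =>
    h c hc _ (hne.mono (oscSeq_subset_oscIter_card _ _ c _ K))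

theorem HasWeaklySummableWith.szlenk_le {B r : ℝ} (h : HasWeaklySummableWith B ξ r K) :
    szlenk K ≤ (Ordinal.omega0 ^ (ξ + 1) : Ordinal.{w}) := by
  refine szlenk_le_iff.2 fun ε hε => ?_
  obtain ⟨n, hn⟩ := exists_nat_gt ((B / ε) ^ r)
  have hempty : derivIter ε (Ordinal.omega0 ^ ξ * n) K = ∅ := by
    by_contra hne
    exact (h ε hε n (Set.nonempty_iff_ne_empty.2 hne)).not_gt hn
  refine Set.subset_eq_empty (derivIter_antitone ε K ?_) hempty
  rw [Ordinal.opow_add_one]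
  gcongr
  exact (Ordinal.natCast_lt_omega0 n).le

theorem HasWeaklySummableWith.szlenkNat_le {B r : ℝ} (h : HasWeaklySummableWith B ξ r K)
    (hB : 0 ≤ B) (hε : 0 < ε) : (szlenkNat ξ K ε : ℝ) ≤ (B / ε) ^ r + 1 := by
  have hempty : derivIter ε (Ordinal.omega0 ^ ξ * (⌊(B / ε) ^ r⌋₊ + 1 : ℕ)) K = ∅ := by
    by_contra hne
    have hle := h ε hε _ (Set.nonempty_iff_ne_empty.2 hne)
    rw [Nat.cast_add_one] at hle
    exact (Nat.lt_floor_add_one _).not_ge hle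
  calc (szlenkNat ξ K ε : ℝ) ≤ (⌊(B / ε) ^ r⌋₊ + 1 : ℕ) := by
        exact_mod_cast SzlenkIndex.szlenkNat_le hempty
    _ ≤ (B / ε) ^ r + 1 := by
        rw [Nat.cast_add_one]
        gcongr
        exact Nat.floor_le (by positivity)

theorem HasWeaklySummableWith.powerType_le {B r : ℝ} (h : HasWeaklySummableWith B ξ r K)
    (hB : 0 ≤ B) (hr : 0 ≤ r) : powerType ξ K ≤ r := by
  rw [powerType_eq_limsup h.szlenk_le]
  refine limsup_log_div_abs_log_le (C := B ^ r + 1)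
    (le_add_of_nonneg_left (Real.rpow_nonneg hB r)) hr ?_
  filter_upwards [Ioo_mem_nhdsGT (zero_lt_one (α := ℝ))] with ε hε
  have hone : 1 ≤ ε ^ (-r) :=
    Real.one_le_rpow_of_pos_of_le_one_of_nonpos hε.1 hε.2.le (neg_nonpos.2 hr)
  calc (szlenkNat ξ K ε : ℝ) ≤ (B / ε) ^ r + 1 := h.szlenkNat_le hB hε.1
    _ = B ^ r * ε ^ (-r) + 1 := by
        rw [Real.div_rpow hB hε.1.le, Real.rpow_neg hε.1.le, div_eq_mul_inv]
    _ ≤ (B ^ r + 1) * ε ^ (-r) := by linarith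

theorem lt_add_of_nonempty_derivIter {R : ℝ} (hR : ∀ x ∈ K, dualNorm 𝕜 X x ≤ R) (hε : 0 < ε)
    (hζ : 0 < ζ) (hne : (derivIter ε ζ K).Nonempty) : ε < R + R := by
  obtain ⟨x, hx⟩ := hne.mono (oscIter_subset_oscDeriv (p := dualNorm 𝕜 X) hζ)
  obtain ⟨y, hy, z, hz, hyz⟩ := hx.2 hε Set.univ univ_mem
  exact hyz.trans_le ((map_sub_le_add _ y z).trans (add_le_add (hR y hy.2) (hR z hz.2)))

theorem exists_hasWeaklySummableWith_of_powerType_lt (hK : IsCompact K)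
    (hb : Bornology.IsBounded K) {r : ℝ} (hr : 0 ≤ r) (h : powerType ξ K < r) :
    ∃ B, 0 ≤ B ∧ HasWeaklySummableWith B ξ r K := by
  have hsz := szlenk_le_of_powerType_lt h
  rw [powerType_eq_limsup hsz] at h
  obtain ⟨δ, hδ, hsmall⟩ :=
    mem_nhdsGT_iff_exists_Ioo_subset.1 (eventually_lt_rpow_neg_of_limsup_log_lt h)
  rw [Set.mem_Ioi] at hδ
  have hcount {ε : ℝ} (hε : ε ∈ Set.Ioo 0 δ) {n : ℕ}
      (hn : (derivIter ε (Ordinal.omega0 ^ ξ * n) K).Nonempty) : (n : ℝ) ≤ (1 / ε) ^ r := by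
    have hlt : (n : ℝ) < szlenkNat ξ K ε := by
      exact_mod_cast lt_szlenkNat hK (szlenk_le_iff.1 hsz ε hε.1) hn
    rw [one_div, Real.inv_rpow hε.1.le, ← Real.rpow_neg hε.1.le]
    exact (hlt.trans (hsmall hε)).le
  obtain ⟨R, hR⟩ := exists_dualNorm_le hb
  refine ⟨max 1 ((R + R) / (δ / 2)), by positivity, fun ε hε n hn => ?_⟩
  rcases lt_or_ge ε δ with hεδ | hδε
  · refine (hcount ⟨hε, hεδ⟩ hn).trans ?_
    gcongr
    exact le_max_left _ _
  rcases Nat.eq_zero_or_pos n with rfl | hpos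
  · rw [Nat.cast_zero]
    positivity
  have hεR : ε < R + R := lt_add_of_nonempty_derivIter hR hε
    (mul_pos (Ordinal.opow_pos ξ Ordinal.omega0_pos) (by exact_mod_cast hpos)) hn
  calc (n : ℝ) ≤ (1 / (δ / 2)) ^ r :=
        hcount ⟨by positivity, by linarith⟩ (hn.mono (derivIter_mono subset_rfl (by linarith) _))
    _ ≤ (max 1 ((R + R) / (δ / 2)) / ε) ^ r := by
        refine Real.rpow_le_rpow (by positivity) ?_ hr
        rw [div_le_div_iff₀ (by positivity) hε, one_mul, ← div_le_iff₀ (by positivity)]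
        exact le_max_of_le_right (by gcongr)

theorem mem_derivIter_weakStarAbsCo {x : WeakDual 𝕜 X} (hx : x ∈ derivIter ε ζ K) {n : ℕ}
    (hn : n ≠ 0) : x ∈ derivIter ((n : ℝ)⁻¹ * ε) (ζ * n) (weakStarAbsCo K) := by
  have hsub := subset_weakStarAbsCo K
  rw [weakStarAbsCo_eq_closedConvexHull] at hsub ⊢
  exact mem_oscIter_mul_nat (p := dualNorm 𝕜 X) hsub convex_closedConvexHull hx hn

theorem one_le_powerType_weakStarAbsCo (hb : Bornology.IsBounded K)
    (h : (Ordinal.omega0 ^ ξ : Ordinal.{w}) < szlenk K) : 1 ≤ powerType ξ (weakStarAbsCo K) := by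
  refine le_of_forall_gt fun r hr => lt_of_le_of_lt ?_ hr
  have hsz := szlenk_le_of_powerType_lt hr
  rw [← not_le, szlenk_le_iff] at h
  push Not at h
  obtain ⟨δ, hδ, x, hx⟩ := h
  rw [powerType_eq_limsup hsz, ← EReal.coe_one]
  refine le_limsup_log_div_abs_log hδ ?_
  filter_upwards [Ioo_mem_nhdsGT hδ] with ε hε
  have hn : ⌊δ / ε⌋₊ ≠ 0 := (Nat.floor_pos.2 ((one_le_div hε.1).2 hε.2.le)).ne'
  have hmem := mem_derivIter_weakStarAbsCo hx hn
  have hle : ε ≤ (⌊δ / ε⌋₊ : ℝ)⁻¹ * δ := by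
    rw [le_inv_mul_iff₀ (by positivity), ← le_div_iff₀ hε.1]
    exact Nat.floor_le (div_nonneg hδ.le hε.1.le)
  have hlt : ((⌊δ / ε⌋₊ + 1 : ℕ) : ℝ) ≤ szlenkNat ξ (weakStarAbsCo K) ε := by
    exact_mod_cast lt_szlenkNat (isCompact_weakStarAbsCo hb) (szlenk_le_iff.1 hsz ε hε.1)
      ⟨x, derivIter_mono subset_rfl hle _ hmem⟩
  rw [Nat.cast_add_one] at hlt
  rw [Real.rpow_neg_one, ← div_eq_mul_inv]
  exact (Nat.lt_floor_add_one _).le.trans hlt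

theorem powerType_weakStarAbsCo (hK : IsCompact K) (hb : Bornology.IsBounded K)
    (h : (Ordinal.omega0 ^ ξ : Ordinal.{w}) < szlenk K) :
    powerType ξ (weakStarAbsCo K) = max (powerType ξ K) 1 := by
  refine le_antisymm (le_of_forall_gt_imp_ge_of_dense fun b hlt => ?_)
    (max_le (powerType_mono (subset_weakStarAbsCo K) (isCompact_weakStarAbsCo hb) ξ)
      (one_le_powerType_weakStarAbsCo hb h))
  obtain ⟨q, hq, hqb⟩ := EReal.lt_iff_exists_real_btwn.1 hlt
  obtain ⟨r, hr, hrq⟩ := EReal.lt_iff_exists_real_btwn.1 hq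
  have hr1 : 1 < r := by exact_mod_cast (le_max_right _ _).trans_lt hr
  have hrq' : r < q := by exact_mod_cast hrq
  obtain ⟨B, hB, hweak⟩ := exists_hasWeaklySummableWith_of_powerType_lt hK hb
    (zero_le_one.trans hr1.le) ((le_max_left _ _).trans_lt hr)
  obtain ⟨M, hM, hhull⟩ := (hasSummable_weakStarAbsCo_iff hK hb (hr1.trans hrq').le).1
    (hweak.hasSummable hB (by linarith) hrq')
  exact ((hhull.hasWeaklySummableWith hM).powerType_le hM (by linarith)).trans hqb.le

theorem szlenk_weakStarAbsCo_le (hK : IsCompact K) (hb : Bornology.IsBounded K)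
    (h : szlenk K ≤ (Ordinal.omega0 ^ ξ : Ordinal.{w})) :
    szlenk (weakStarAbsCo K) ≤ (Ordinal.omega0 ^ ξ : Ordinal.{w}) := by
  rw [szlenk_le_iff] at h ⊢
  intro ε hε
  by_contra hne
  have hle : ε / 8 ≤ 0 := apply_div_eight_le_of_nonempty_oscSeq (n := 1) (φ := fun c => c 0)
    (a := fun _ => ε) hK hb ((LinearMap.proj 0).convexOn convex_univ) (by fun_prop)
    (fun c hc => not_lt.1 fun hpos => hc.ne_empty (h (c 0) hpos)) (fun _ => hε.le)
    (Set.nonempty_iff_ne_empty.2 hne)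
  linarith

end PowerType

end SzlenkIndex

end

theorem mainTheorem5_general {𝕜 : Type u} [RCLike 𝕜] {X : Type v} [NormedAddCommGroup X]
    [NormedSpace 𝕜 X] (ξ : Ordinal.{w}) (K : Set (WeakDual 𝕜 X))
    (hK : IsCompact K) (hb : Bornology.IsBounded K) :
    (∀ q : ℝ, 1 ≤ q →
      (SzlenkIndex.HasSummable ξ q K ↔
        SzlenkIndex.HasSummable ξ q (SzlenkIndex.weakStarAbsCo K))) ∧
    (((Ordinal.omega0 ^ ξ : Ordinal.{w}) : WithTop Ordinal.{w}) < SzlenkIndex.szlenk K →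
      SzlenkIndex.powerType ξ (SzlenkIndex.weakStarAbsCo K) =
        max (SzlenkIndex.powerType ξ K) 1) ∧
    (K.Nonempty →
      SzlenkIndex.szlenk K ≤ ((Ordinal.omega0 ^ ξ : Ordinal.{w}) : WithTop Ordinal.{w}) →
        SzlenkIndex.powerType ξ K = 0 ∧
          SzlenkIndex.powerType ξ (SzlenkIndex.weakStarAbsCo K) = 0) :=
  ⟨fun _ hq => SzlenkIndex.hasSummable_weakStarAbsCo_iff hK hb hq,
    SzlenkIndex.powerType_weakStarAbsCo hK hb,
    fun _ hsz => ⟨SzlenkIndex.powerType_eq_zero hsz,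
      SzlenkIndex.powerType_eq_zero (SzlenkIndex.szlenk_weakStarAbsCo_le hK hb hsz)⟩⟩

theorem mainTheorem5 {𝕜 : Type u} [RCLike 𝕜] {X : Type v} [NormedAddCommGroup X]
    [NormedSpace 𝕜 X] [CompleteSpace X] (ξ : Ordinal.{w}) (K : Set (WeakDual 𝕜 X))
    (hK : IsCompact K) :
    (∀ q : ℝ, 1 ≤ q →
      (SzlenkIndex.HasSummable ξ q K ↔
        SzlenkIndex.HasSummable ξ q (SzlenkIndex.weakStarAbsCo K))) ∧
    (((Ordinal.omega0 ^ ξ : Ordinal.{w}) : WithTop Ordinal.{w}) < SzlenkIndex.szlenk K →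
      SzlenkIndex.powerType ξ (SzlenkIndex.weakStarAbsCo K) =
        max (SzlenkIndex.powerType ξ K) 1) ∧
    (K.Nonempty →
      SzlenkIndex.szlenk K ≤ ((Ordinal.omega0 ^ ξ : Ordinal.{w}) : WithTop Ordinal.{w}) →
        SzlenkIndex.powerType ξ K = 0 ∧
          SzlenkIndex.powerType ξ (SzlenkIndex.weakStarAbsCo K) = 0) :=
  mainTheorem5_general ξ K hK (WeakDual.isBounded_iff_isVonNBounded.2 (hK.isVonNBounded 𝕜))
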